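/- Conventions. For $n\ge 1$ let $Q=[0,1]^n$, let $|\cdot|$ denote Lebesgue measure (of sets), and let $\widehat f(\xi)=\int_{\mathbb R^n} f(x)e^{-2\pi i x\cdot\xi}\,dx$. A *sector* in $\mathbb R^n$ is a nonempty set of the form $$X=\{x\in\mathbb R^n:\ x\cdot v_j>0 \text{ for } 1\le j\le s,\ \ x\cdot v_j<0 \text{ for } s<j\le r\},$$ where $v_1,\dots,v_r$ are distinct unit vectors in $\mathbb R^n$ and $0\le s\le r$. Every integer $1\le N\le 2^m-1$ is written uniquely as $N=2^k+j-1$ with $0\le k\le m-1$ and $1\le j\le 2^k$; put $t_N=\frac{2j-1}{2^{k+1}}$. The numbers $t_1,\dots,t_{2^m-1}$ are distinct, and $\sigma=\sigma_m$ denotes the unique permutation of $\{1,\dots,2^m-1\}$ such that $t_{\sigma(1)}<t_{\sigma(2)}<\dots<t_{\sigma(2^m-1)}$. **Proposition 3.2.** Let $n\ge 1$ and $p_0\ge 1$ be integers. There exist constants $C_1,C_2,C_3>0$, depending only on $p_0$ and $n$, such that the following holds. Let $m\ge 1$ be an integer and let $X_1,\dots,X_{2^m-1}$ be any pairwise disjoint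 sectors in $\mathbb R^n$. Then there exist smooth, integrable functions $f_N:\mathbb R^n\to\mathbb C$, $N=1,\dots,2^m-1$, with compactly supported Fourier transforms, such that (a) $\operatorname{supp}\widehat f_N\subset X_N$ for each $N$; (b) for every real $p\in[1,2p_0]$, $$\Big\|\sum_{N=1}^{2^m-1}f_N\Big\|_{L^p(\mathbb R^n)}\le C_1\sqrt m;$$ (c) $$\Big|\Big\{x\in Q:\ \max_{1\le l<2^m}\Big|\sum_{N=1}^{l}f_{\sigma(N)}(x)\Big|\ge C_2\,m\Big\}\Big|>C_3.$$ -/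

import Mathlib

open MeasureTheory FourierTransform
open scoped ContDiff RealInnerProductSpace

/-- A sector in `ℝⁿ`: a nonempty set cut out by finitely many strict inequalities
`x · v_j > 0` (for the first `s` vectors) and `x · v_j < 0` (for the remaining ones), where
`v_1, …, v_r` are distinct unit vectors and `s ≤ r`. -/
def IsSector {n : ℕ} (X : Set (EuclideanSpace ℝ (Fin n))) : Prop :=
  X.Nonempty ∧
    ∃ (r s : ℕ) (v : Fin r → EuclideanSpace ℝ (Fin n)),
      s ≤ r ∧ Function.Injective v ∧ (∀ j, ‖v j‖ = 1) ∧
        X = {x | (∀ j : Fin r, (j : ℕ) < s → 0 < ⟪x, v j⟫) ∧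
                 (∀ j : Fin r, s ≤ (j : ℕ) → ⟪x, v j⟫ < 0)}

/-- The unit cube `Q = [0,1]ⁿ`. -/
def unitCube (n : ℕ) : Set (EuclideanSpace ℝ (Fin n)) :=
  {x | ∀ i, x i ∈ Set.Icc (0 : ℝ) 1}

/-- The index set `{1, 2, …, 2^m - 1}`, with its usual order. -/
abbrev DyadicIndex (m : ℕ) : Type := Set.Ico (1 : ℕ) (2 ^ m)

/-- For `N = 2^k + j - 1` with `1 ≤ j ≤ 2^k`, this is `k`. -/
def dyadicHeight (N : ℕ) : ℕ := Nat.log 2 N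

/-- For `N = 2^k + j - 1` with `1 ≤ j ≤ 2^k`, this is `j`. -/
def dyadicPosition (N : ℕ) : ℕ := N + 1 - 2 ^ dyadicHeight N

/-- The number `t_N = (2j - 1) / 2^(k+1)` for `N = 2^k + j - 1`, `1 ≤ j ≤ 2^k`. -/
noncomputable def dyadicPoint (N : ℕ) : ℝ :=
  (2 * (dyadicPosition N : ℝ) - 1) / 2 ^ (dyadicHeight N + 1)

theorem dyadic_decomposition {N : ℕ} (hN : 1 ≤ N) :
    N + 1 = 2 ^ dyadicHeight N + dyadicPosition N ∧
      1 ≤ dyadicPosition N ∧ dyadicPosition N ≤ 2 ^ dyadicHeight N := by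
  have h1 : 2 ^ dyadicHeight N ≤ N := Nat.pow_log_le_self 2 (by omega)
  have h2 : N < 2 ^ (dyadicHeight N + 1) := Nat.lt_pow_succ_log_self (by norm_num) N
  rw [pow_succ] at h2
  unfold dyadicPosition
  omega

theorem dyadicPoint_inj_aux {N M : ℕ} (hN : 1 ≤ N) (hM : 1 ≤ M)
    (hle : dyadicHeight N ≤ dyadicHeight M) (h : dyadicPoint N = dyadicPoint M) : N = M := by
  obtain ⟨hN1, hN2, -⟩ := dyadic_decomposition hN
  obtain ⟨hM1, hM2, -⟩ := dyadic_decomposition hM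
  obtain ⟨d, hd⟩ := Nat.exists_eq_add_of_le hle
  unfold dyadicPoint at h
  rw [hd, div_eq_div_iff (by positivity) (by positivity)] at h
  have h' : (2 * (dyadicPosition N : ℝ) - 1) * 2 ^ d = 2 * (dyadicPosition M : ℝ) - 1 := by
    have hp : (0 : ℝ) < 2 ^ (dyadicHeight N + 1) := by positivity
    apply mul_right_cancel₀ hp.ne'
    rw [← h]
    ring
  have hz : (2 * (dyadicPosition N : ℤ) - 1) * 2 ^ d = 2 * (dyadicPosition M : ℤ) - 1 := by
    exact_mod_cast h'
  rcases d with _ | d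
  · simp only [add_zero] at hd
    rw [hd] at hM1
    simp only [pow_zero, mul_one] at hz
    omega
  · exfalso
    rw [pow_succ, ← mul_assoc] at hz
    omega

theorem dyadicPoint_injOn : Set.InjOn dyadicPoint (Set.Ici 1) := by
  intro N hN M hM h
  rcases le_total (dyadicHeight N) (dyadicHeight M) with hle | hle
  · exact dyadicPoint_inj_aux hN hM hle h
  · exact (dyadicPoint_inj_aux hM hN hle h.symm).symm

/-- There is exactly one permutation `σ` of `{1, …, 2^m - 1}` such that
`t_{σ(1)} < t_{σ(2)} < ⋯ < t_{σ(2^m - 1)}`. -/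
theorem existsUnique_dyadicPerm (m : ℕ) :
    ∃! σ : Equiv.Perm (DyadicIndex m), StrictMono (fun l => dyadicPoint (σ l : ℕ)) := by
  have hinj : Function.Injective (fun N : DyadicIndex m => dyadicPoint (N : ℕ)) := by
    intro N M h
    exact Subtype.ext (dyadicPoint_injOn N.2.1 M.2.1 h)
  refine existsUnique_of_exists_of_unique ?_ ?_
  · let e := Fintype.orderIsoFinOfCardEq (DyadicIndex m) rfl
    let g : Fin (Fintype.card (DyadicIndex m)) → ℝ := fun i => dyadicPoint (e i : ℕ)
    refine ⟨(e.symm.toEquiv.trans (Tuple.sort g)).trans e.toEquiv, ?_⟩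
    have hmono : Monotone (g ∘ Tuple.sort g) := Tuple.monotone_sort g
    have hs : StrictMono (g ∘ Tuple.sort g) :=
      hmono.strictMono_of_injective
        ((hinj.comp e.injective).comp (Tuple.sort g).injective)
    exact hs.comp e.symm.strictMono
  · intro σ τ hσ hτ
    have hr : Set.range (fun l => dyadicPoint (σ l : ℕ)) =
        Set.range (fun l => dyadicPoint (τ l : ℕ)) := by
      have key : ∀ ρ : Equiv.Perm (DyadicIndex m), Set.range (fun l => dyadicPoint (ρ l : ℕ)) =
          Set.range (fun N : DyadicIndex m => dyadicPoint (N : ℕ)) := fun ρ =>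
        ρ.surjective.range_comp (fun N : DyadicIndex m => dyadicPoint (N : ℕ))
      rw [key σ, key τ]
    have he := (StrictMono.range_inj hσ hτ).1 hr
    exact Equiv.ext fun l => hinj (congrFun he l)

/-- The permutation `σ` of `{1, …, 2^m - 1}` with `t_{σ(1)} < t_{σ(2)} < ⋯ < t_{σ(2^m - 1)}`. -/
noncomputable def dyadicPerm (m : ℕ) : Equiv.Perm (DyadicIndex m) :=
  (existsUnique_dyadicPerm m).choose

theorem dyadicPerm_strictMono (m : ℕ) :
    StrictMono (fun l => dyadicPoint (dyadicPerm m l : ℕ)) :=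
  (existsUnique_dyadicPerm m).choose_spec.1

theorem eq_dyadicPerm {m : ℕ} {σ : Equiv.Perm (DyadicIndex m)}
    (hσ : StrictMono (fun l => dyadicPoint (σ l : ℕ))) : σ = dyadicPerm m :=
  (existsUnique_dyadicPerm m).unique hσ (dyadicPerm_strictMono m)

/-! Number the nodes of a binary tree so that `N` has children `2 * N` and `2 * N + 1`. Then
`dyadicPerm` is the in-order traversal: everything below `2 * N` precedes `N`, and everything below
`2 * N + 1` follows it (`dyadicPoint_gt_of_div_eq`, `dyadicPoint_lt_of_div_eq`).

Take independent uniform unit complex numbers `z_N` and walk down from the root, turning right at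
`N` if `Re z_N > 0` and left otherwise. Let `w_N` be the indicator of visiting `N`. Then `∑ w_N z_N`
in the natural order is a martingale sum, as `w_N` depends only on the ancestors of `N`, and `∑ w_N
^ 2 = m`, so its moments have size `√m` (`integral_norm_sum_pow_le`). In the in-order, a visited
node precedes the end of the walk exactly when the walk turned right there, so stopping at that end
keeps exactly the terms with `Re z_N > 0`. These add up to a multiple of `m` on average
(`exists_threshold_sum_ge`, `le_integral_sum_posPart`).

To get band-limited functions, the indicator of `Re z_N > 0` is replaced by a polynomial `q (Re
z_N)` with values in `[0, 1]`. Weights are split between the two children, so each level still has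
total weight one (`exists_polynomial_le_integral_torusMax`).

Finally set `z_N = exp (2 π i ⟪ν_N, x⟫)` with each `ν_N` deep inside its sector and far longer than
all earlier ones. Then `w_N` is a trigonometric polynomial in the earlier frequencies, so `w_N z_N
φ`, with `φ` a band-limited envelope, has spectrum near `ν_N`
(`torusWeight_torusPoint_mem_trigPoly`, `mul_trigPoly_spec`). The phases equidistribute as the
lacunarity grows (`tendsto_integral_comp_torusPoint`), which carries the torus estimates over to
`ℝⁿ`. -/

/-! ### Weights on the dyadic tree -/

/-- The weight of a node of the binary tree on `1, 2, 3, …` (with children `2 N` and `2 N + 1`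
of `N`), when one descends from `N` to `2 N + 1` with weight `a N` and to `2 N` with weight
`1 - a N`. -/
noncomputable def treeWeight (a : ℕ → ℝ) (N : ℕ) : ℝ :=
  if N ≤ 1 then 1
  else treeWeight a (N / 2) * (if N % 2 = 1 then a (N / 2) else 1 - a (N / 2))
termination_by N
decreasing_by omega

theorem treeWeight_of_le_one (a : ℕ → ℝ) {N : ℕ} (hN : N ≤ 1) : treeWeight a N = 1 := by
  rw [treeWeight, if_pos hN]

theorem treeWeight_of_one_lt (a : ℕ → ℝ) {N : ℕ} (hN : 1 < N) :
    treeWeight a N =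
      treeWeight a (N / 2) * (if N % 2 = 1 then a (N / 2) else 1 - a (N / 2)) := by
  rw [treeWeight, if_neg (by omega)]

theorem treeWeight_two_mul (a : ℕ → ℝ) {N : ℕ} (hN : 1 ≤ N) :
    treeWeight a (2 * N) = treeWeight a N * (1 - a N) := by
  rw [treeWeight_of_one_lt a (by omega), if_neg (by omega), show 2 * N / 2 = N by omega]

theorem treeWeight_two_mul_add_one (a : ℕ → ℝ) {N : ℕ} (hN : 1 ≤ N) :
    treeWeight a (2 * N + 1) = treeWeight a N * a N := by
  rw [treeWeight_of_one_lt a (by omega), if_pos (by omega), show (2 * N + 1) / 2 = N by omega]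

/-- Only strict ancestors enter, and they have smaller indices. This predictability gives the
martingale structure and, later, the location of the spectra. -/
theorem treeWeight_congr {a b : ℕ → ℝ} {N : ℕ} (h : ∀ M, 1 ≤ M → M < N → a M = b M) :
    treeWeight a N = treeWeight b N := by
  induction N using Nat.strong_induction_on with
  | _ N ih =>
    by_cases hN : N ≤ 1
    · rw [treeWeight_of_le_one a hN, treeWeight_of_le_one b hN]
    · rw [treeWeight_of_one_lt a (by omega), treeWeight_of_one_lt b (by omega),
        h (N / 2) (by omega) (by omega),
        ih (N / 2) (by omega) fun M h1 h2 => h M h1 (by omega)]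

theorem treeWeight_nonneg {a : ℕ → ℝ} (h0 : ∀ N, 0 ≤ a N) (h1 : ∀ N, a N ≤ 1) (N : ℕ) :
    0 ≤ treeWeight a N := by
  induction N using Nat.strong_induction_on with
  | _ N ih =>
    by_cases hN : N ≤ 1
    · rw [treeWeight_of_le_one a hN]; exact zero_le_one
    · rw [treeWeight_of_one_lt a (by omega)]
      refine mul_nonneg (ih _ (by omega)) ?_
      split_ifs
      · exact h0 _
      · exact sub_nonneg.2 (h1 _)

theorem sum_Ico_double (g : ℕ → ℝ) (A B : ℕ) (hAB : A ≤ B) :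
    ∑ N ∈ Finset.Ico (2 * A) (2 * B), g N =
      ∑ N ∈ Finset.Ico A B, (g (2 * N) + g (2 * N + 1)) := by
  induction B, hAB using Nat.le_induction with
  | base => simp
  | succ B hB ih =>
    rw [Finset.sum_Ico_succ_top hB, ← ih, show 2 * (B + 1) = 2 * B + 1 + 1 by ring,
      Finset.sum_Ico_succ_top (by omega), Finset.sum_Ico_succ_top (by omega)]
    ring

/-- The two children share exactly the weight of their parent, so every level inherits the total
weight of the root. -/
theorem sum_treeWeight_level (a : ℕ → ℝ) (k : ℕ) :
    ∑ N ∈ Finset.Ico (2 ^ k) (2 ^ (k + 1)), treeWeight a N = 1 := by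
  induction k with
  | zero => simp [treeWeight_of_le_one]
  | succ k ih =>
    rw [pow_succ' 2 k, pow_succ' 2 (k + 1), sum_Ico_double _ _ _ (by gcongr <;> omega), ← ih]
    refine Finset.sum_congr rfl fun N hN => ?_
    have hN1 : 1 ≤ N := (Nat.one_le_two_pow).trans (Finset.mem_Ico.1 hN).1
    rw [treeWeight_two_mul a hN1, treeWeight_two_mul_add_one a hN1]
    ring

theorem sum_Ico_levels {E : Type*} [AddCommMonoid E] (g : ℕ → E) (m : ℕ) :
    ∑ N ∈ Finset.Ico 1 (2 ^ m), g N =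
      ∑ k ∈ Finset.range m, ∑ N ∈ Finset.Ico (2 ^ k) (2 ^ (k + 1)), g N := by
  induction m with
  | zero => simp
  | succ m ih =>
    rw [Finset.sum_range_succ, ← ih, Finset.sum_Ico_consecutive _ Nat.one_le_two_pow
      (Nat.pow_le_pow_right (by norm_num) (Nat.le_succ m))]

theorem sum_treeWeight (a : ℕ → ℝ) (m : ℕ) :
    ∑ N ∈ Finset.Ico 1 (2 ^ m), treeWeight a N = m := by
  simp [sum_Ico_levels, sum_treeWeight_level]

theorem treeWeight_le_one {a : ℕ → ℝ} (h0 : ∀ N, 0 ≤ a N) (h1 : ∀ N, a N ≤ 1) (N : ℕ) :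
    treeWeight a N ≤ 1 := by
  by_cases hN : N = 0
  · rw [treeWeight_of_le_one a (by omega)]
  · rw [← sum_treeWeight_level a (Nat.log 2 N)]
    exact Finset.single_le_sum (f := treeWeight a) (fun i _ => treeWeight_nonneg h0 h1 i)
      (Finset.mem_Ico.2 ⟨Nat.pow_log_le_self 2 hN, Nat.lt_pow_succ_log_self (by norm_num) N⟩)

/-! ### The order of the dyadic points -/

theorem dyadicPoint_of_mem {k N : ℕ} (h1 : 2 ^ k ≤ N) (h2 : N < 2 ^ (k + 1)) :
    dyadicPoint N = (N + 1 / 2) / 2 ^ k - 1 := by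
  have hk : dyadicHeight N = k := (Nat.log_eq_iff (Or.inr ⟨by norm_num, by
    have := Nat.one_le_two_pow (n := k); omega⟩)).2 ⟨h1, h2⟩
  have hp : (dyadicPosition N : ℝ) = N + 1 - 2 ^ k := by
    rw [dyadicPosition, hk, Nat.cast_sub (by omega)]
    push_cast; ring
  rw [dyadicPoint, hp, hk, pow_succ]
  field_simp
  ring

/-- All nodes of the subtree of `2 N + 1` lie to the right of `N`. -/
theorem dyadicPoint_lt_of_div_eq {k d N A : ℕ} (h1 : 2 ^ k ≤ N) (h2 : N < 2 ^ (k + 1))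
    (hA : A / 2 ^ d = 2 * N + 1) : dyadicPoint N < dyadicPoint A := by
  have hd : 0 < 2 ^ d := by positivity
  -- The descendants of `2 * N + 1` after `d` generations form an interval of indices on level `k +
  -- 1 + d`.
  have hA1 : (2 * N + 1) * 2 ^ d ≤ A := (Nat.le_div_iff_mul_le hd).1 hA.ge
  have hA2 : A < (2 * N + 2) * 2 ^ d := (Nat.div_lt_iff_lt_mul hd).1 (by omega)
  have e1 : 2 ^ (k + 1 + d) = 2 * 2 ^ k * 2 ^ d := by ring
  have e2 : 2 ^ (k + 1 + d + 1) = 4 * 2 ^ k * 2 ^ d := by ring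
  rw [pow_succ] at h2
  rw [dyadicPoint_of_mem h1 (by rw [pow_succ]; exact h2),
    dyadicPoint_of_mem (k := k + 1 + d) (N := A)
      (by rw [e1]; exact le_trans (Nat.mul_le_mul_right _ (by omega)) hA1)
      (by rw [e2]; exact lt_of_lt_of_le hA2 (Nat.mul_le_mul_right _ (by omega)))]
  have hA3 : ((2 * N + 1) * 2 ^ d : ℝ) ≤ A := by exact_mod_cast hA1
  gcongr ?_ - 1
  rw [div_lt_div_iff₀ (by positivity) (by positivity), pow_add, pow_succ]
  have : (0 : ℝ) < 2 ^ k := by positivity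
  nlinarith

/-- All nodes of the subtree of `2 N` lie to the left of `N`. -/
theorem dyadicPoint_gt_of_div_eq {k d N A : ℕ} (h1 : 2 ^ k ≤ N) (h2 : N < 2 ^ (k + 1))
    (hA : A / 2 ^ d = 2 * N) : dyadicPoint A < dyadicPoint N := by
  have hd : 0 < 2 ^ d := by positivity
  have hA1 : (2 * N) * 2 ^ d ≤ A := (Nat.le_div_iff_mul_le hd).1 hA.ge
  have hA2 : A < (2 * N + 1) * 2 ^ d := (Nat.div_lt_iff_lt_mul hd).1 (by omega)
  have e1 : 2 ^ (k + 1 + d) = 2 * 2 ^ k * 2 ^ d := by ring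
  have e2 : 2 ^ (k + 1 + d + 1) = 4 * 2 ^ k * 2 ^ d := by ring
  rw [pow_succ] at h2
  rw [dyadicPoint_of_mem h1 (by rw [pow_succ]; exact h2),
    dyadicPoint_of_mem (k := k + 1 + d) (N := A)
      (by rw [e1]; exact le_trans (Nat.mul_le_mul_right _ (by omega)) hA1)
      (by rw [e2]; exact lt_of_lt_of_le hA2 (Nat.mul_le_mul_right _ (by omega)))]
  have hA3 : (A + 1 : ℝ) ≤ (2 * N + 1) * 2 ^ d := by exact_mod_cast hA2
  gcongr ?_ - 1
  rw [div_lt_div_iff₀ (by positivity) (by positivity), pow_add, pow_succ]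
  have : (0 : ℝ) < 2 ^ k := by positivity
  nlinarith

/-! ### Descending along signs -/

/-- The node of level `k` reached from the root by descending to the right child at the nodes
with `0 < c N` and to the left child at the others. -/
noncomputable def signPath (c : ℕ → ℝ) : ℕ → ℕ
  | 0 => 1
  | k + 1 => if 0 < c (signPath c k) then 2 * signPath c k + 1 else 2 * signPath c k

theorem signPath_mem (c : ℕ → ℝ) (k : ℕ) :
    signPath c k ∈ Finset.Ico (2 ^ k) (2 ^ (k + 1)) := by
  induction k with
  | zero => simp [signPath]
  | succ k ih =>
    rw [Finset.mem_Ico] at ih ⊢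
    rw [signPath, pow_succ 2 (k + 1), pow_succ 2 k] at *
    split_ifs <;> omega

theorem signPath_add_div (c : ℕ → ℝ) (k d : ℕ) : signPath c (k + d) / 2 ^ d = signPath c k := by
  induction d with
  | zero => simp
  | succ d ih =>
    rw [pow_succ', ← Nat.div_div_eq_div_mul, ← ih, ← add_assoc, signPath]
    congr 1
    split_ifs <;> omega

/-- The later node of the path is a strict descendant of the earlier one, so its side is decided by
the turn taken there. -/
theorem dyadicPoint_signPath_le_iff (c : ℕ → ℝ) {k m : ℕ} (hk : k < m) :
    dyadicPoint (signPath c k) ≤ dyadicPoint (signPath c m) ↔ 0 < c (signPath c k) := by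
  obtain ⟨d, rfl⟩ := Nat.exists_eq_add_of_lt hk
  have hm := Finset.mem_Ico.1 (signPath_mem c k)
  have hdiv := signPath_add_div c (k + 1) d
  rw [show k + 1 + d = k + d + 1 by ring, show signPath c (k + 1) =
    if 0 < c (signPath c k) then 2 * signPath c k + 1 else 2 * signPath c k from rfl] at hdiv
  split_ifs at hdiv with h
  · exact iff_of_true (dyadicPoint_lt_of_div_eq hm.1 hm.2 hdiv).le h
  · exact iff_of_false (dyadicPoint_gt_of_div_eq hm.1 hm.2 hdiv).not_ge h

/-- Each step along the path keeps a fraction at least `1 - ε` of the weight; Bernoulli's inequality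
does the rest. -/
theorem one_sub_le_treeWeight_signPath {a c : ℕ → ℝ} {ε : ℝ} {m : ℕ} (hε : 0 ≤ ε)
    (h0 : ∀ N, 0 ≤ a N) (h1 : ∀ N, a N ≤ 1)
    (hpos : ∀ N, 1 ≤ N → N < 2 ^ m → 0 < c N → 1 - ε ≤ a N)
    (hneg : ∀ N, 1 ≤ N → N < 2 ^ m → ¬ 0 < c N → a N ≤ ε) {k : ℕ} (hk : k ≤ m) :
    1 - k * ε ≤ treeWeight a (signPath c k) := by
  induction k with
  | zero => simp [signPath, treeWeight_of_le_one]
  | succ k ih =>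
    have hm := Finset.mem_Ico.1 (signPath_mem c k)
    have hN1 : 1 ≤ signPath c k := Nat.one_le_two_pow.trans hm.1
    have hN2 : signPath c k < 2 ^ m :=
      hm.2.trans_le (Nat.pow_le_pow_right (by norm_num) hk)
    have ih := ih (by omega)
    have hw0 := treeWeight_nonneg h0 h1 (signPath c k)
    have hw1 := treeWeight_le_one h0 h1 (signPath c k)
    have key : ∀ b, 1 - ε ≤ b → 1 - (k + 1 : ℕ) * ε ≤ treeWeight a (signPath c k) * b := by
      intro b hb
      push_cast
      nlinarith [mul_le_mul_of_nonneg_left hb hw0]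
    rw [signPath]
    split_ifs with h
    · rw [treeWeight_two_mul_add_one a hN1]
      exact key _ (hpos _ hN1 hN2 h)
    · rw [treeWeight_two_mul a hN1]
      exact key _ (by linarith [hneg _ hN1 hN2 h])

/-- If the weights `a` almost follow the signs of `c`, some partial sum of `treeWeight a N * c N`
in the order of the dyadic points almost picks out all the positive terms. -/
theorem exists_threshold_sum_ge {a c : ℕ → ℝ} {ε : ℝ} {m : ℕ} (hε : 0 ≤ ε)
    (h0 : ∀ N, 0 ≤ a N) (h1 : ∀ N, a N ≤ 1) (hc : ∀ N, |c N| ≤ 1)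
    (hpos : ∀ N, 1 ≤ N → N < 2 ^ m → 0 < c N → 1 - ε ≤ a N)
    (hneg : ∀ N, 1 ≤ N → N < 2 ^ m → ¬ 0 < c N → a N ≤ ε) :
    ∃ τ : ℝ, ∑ N ∈ Finset.Ico 1 (2 ^ m), treeWeight a N * max (c N) 0 - m * (m * ε) ≤
      ∑ N ∈ Finset.Ico 1 (2 ^ m), if dyadicPoint N ≤ τ then treeWeight a N * c N else 0 := by
  -- The threshold sits on level `m`, one below the last level summed, so every path node in the sum
  -- is strictly above it in the tree.
  refine ⟨dyadicPoint (signPath c m), ?_⟩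
  rw [sub_le_iff_le_add, sum_Ico_levels, sum_Ico_levels]
  have hconst : (m * (m * ε) : ℝ) = ∑ _k ∈ Finset.range m, (m * ε : ℝ) := by simp
  rw [hconst, ← Finset.sum_add_distrib]
  refine Finset.sum_le_sum fun k hk => ?_
  have hk := Finset.mem_range.1 hk
  have hmem := signPath_mem c k
  have hw := one_sub_le_treeWeight_signPath hε h0 h1 hpos hneg hk.le
  have hsum := sum_treeWeight_level a k
  rw [← Finset.add_sum_erase _ _ hmem] at hsum ⊢
  rw [← Finset.add_sum_erase _ _ hmem]
  have hpath : treeWeight a (signPath c k) * max (c (signPath c k)) 0 =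
      if dyadicPoint (signPath c k) ≤ dyadicPoint (signPath c m)
        then treeWeight a (signPath c k) * c (signPath c k) else 0 := by
    simp only [dyadicPoint_signPath_le_iff c hk]
    split_ifs with h
    · rw [max_eq_left h.le]
    · rw [max_eq_right (not_lt.1 h), mul_zero]
  -- Off the path, each term errs by at most its weight, and the path leaves at most `k * ε` of the
  -- weight of level `k` to the other nodes.
  have hoff : ∑ N ∈ (Finset.Ico (2 ^ k) (2 ^ (k + 1))).erase (signPath c k),
        treeWeight a N * max (c N) 0 ≤
      ∑ N ∈ (Finset.Ico (2 ^ k) (2 ^ (k + 1))).erase (signPath c k),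
        (if dyadicPoint N ≤ dyadicPoint (signPath c m) then treeWeight a N * c N else 0) +
      ∑ N ∈ (Finset.Ico (2 ^ k) (2 ^ (k + 1))).erase (signPath c k), treeWeight a N := by
    rw [← Finset.sum_add_distrib]
    refine Finset.sum_le_sum fun N _ => ?_
    have hw0 := treeWeight_nonneg h0 h1 N
    obtain ⟨hc1, hc2⟩ := abs_le.1 (hc N)
    rcases max_cases (c N) 0 with ⟨h, h'⟩ | ⟨h, h'⟩ <;> rw [h] <;> split_ifs <;> nlinarith
  have hkm : (k * ε : ℝ) ≤ m * ε := by gcongr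
  rw [hpath]
  linarith

/-- Every sum over the indices with `t_N ≤ τ` is bounded by the largest partial sum in the order
of the dyadic points. -/
theorem norm_sum_threshold_le_iSup {m : ℕ} (f : DyadicIndex m → ℂ) (τ : ℝ) :
    ‖∑ N : DyadicIndex m, if dyadicPoint (N : ℕ) ≤ τ then f N else 0‖ ≤
      ⨆ l : DyadicIndex m,
        ‖∑ N ∈ Finset.univ.filter (fun N => N ≤ l), f (dyadicPerm m N)‖ := by
  classical
  rw [← Equiv.sum_comp (dyadicPerm m)]
  rw [← Finset.sum_filter]
  set s : Finset (DyadicIndex m) :=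
    Finset.univ.filter fun N => dyadicPoint (dyadicPerm m N : ℕ) ≤ τ with hs
  rcases s.eq_empty_or_nonempty with h | h
  · rw [h, Finset.sum_empty, norm_zero]
    exact Real.iSup_nonneg fun l => norm_nonneg _
  -- Monotonicity along `dyadicPerm` makes the set downward closed, hence the initial segment ending
  -- at its maximum.
  · have : s = Finset.univ.filter fun N => N ≤ s.max' h := by
      ext N
      simp only [Finset.mem_filter, Finset.mem_univ, true_and]
      refine ⟨fun hN => s.le_max' N hN, fun hN => ?_⟩
      have h1 := (Finset.mem_filter.1 (s.max'_mem h)).2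
      exact Finset.mem_filter.2
        ⟨Finset.mem_univ _, ((dyadicPerm_strictMono m).monotone hN).trans h1⟩
    rw [this]
    exact le_ciSup (f := fun l : DyadicIndex m =>
      ‖∑ N ∈ Finset.univ.filter (fun N => N ≤ l), f (dyadicPerm m N)‖)
      (Set.finite_range _).bddAbove (s.max' h)

/-! ### The random tree on the torus -/

theorem Continuous.integrable_of_compactSpace {X E : Type*} [TopologicalSpace X] [CompactSpace X]
    [MeasurableSpace X] [OpensMeasurableSpace X] [NormedAddCommGroup E]
    [SecondCountableTopologyEither X E] {f : X → E} (hf : Continuous f) (μ : Measure X)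
    [IsFiniteMeasure μ] : Integrable f μ :=
  hf.integrable_of_hasCompactSupport (HasCompactSupport.of_compactSpace f)

theorem UnitAddCircle.toCircle_half :
    (AddCircle.toCircle ((1 / 2 : ℝ) : UnitAddCircle) : ℂ) = -1 := by
  rw [AddCircle.toCircle_apply_mk, Circle.coe_exp]
  rw [show ((2 * Real.pi / 1 * (1 / 2) : ℝ) : ℂ) * Complex.I = Real.pi * Complex.I by
    push_cast; ring]
  exact Complex.exp_pi_mul_I

theorem UnitAddCircle.toCircle_quarter :
    (AddCircle.toCircle ((1 / 4 : ℝ) : UnitAddCircle) : ℂ) = Complex.I := by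
  rw [AddCircle.toCircle_apply_mk, Circle.coe_exp]
  rw [show ((2 * Real.pi / 1 * (1 / 4) : ℝ) : ℂ) * Complex.I = Real.pi / 2 * Complex.I by
    push_cast; ring]
  exact Complex.exp_pi_div_two_mul_I

/-- The `N`-th coordinate of a point of the torus, as a complex number of modulus `1`
(and `1` if `N` is not an index). -/
noncomputable def torusCoord {m : ℕ} (θ : UnitAddTorus (DyadicIndex m)) (N : ℕ) : ℂ :=
  if h : N ∈ Set.Ico 1 (2 ^ m) then ((θ ⟨N, h⟩).toCircle : ℂ) else 1

/-- The weights on the tree with `a N = q (Re z_N)`, where `z_N` is the `N`-th coordinate. -/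
noncomputable def torusWeight {m : ℕ} (q : Polynomial ℝ) (θ : UnitAddTorus (DyadicIndex m))
    (N : ℕ) : ℝ :=
  treeWeight (fun M => q.eval (torusCoord θ M).re) N

section Torus

variable {m : ℕ} {q : Polynomial ℝ} {θ : UnitAddTorus (DyadicIndex m)} {N M : ℕ}

theorem norm_torusCoord (θ : UnitAddTorus (DyadicIndex m)) (N : ℕ) : ‖torusCoord θ N‖ = 1 := by
  unfold torusCoord
  split_ifs
  · exact Circle.norm_coe _
  · exact norm_one

theorem abs_re_torusCoord_le (θ : UnitAddTorus (DyadicIndex m)) (N : ℕ) :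
    |(torusCoord θ N).re| ≤ 1 :=
  (Complex.abs_re_le_norm _).trans (norm_torusCoord θ N).le

theorem continuous_torusCoord (N : ℕ) :
    Continuous fun θ : UnitAddTorus (DyadicIndex m) => torusCoord θ N := by
  unfold torusCoord
  split_ifs with h
  · exact continuous_subtype_val.comp (AddCircle.continuous_toCircle.comp (continuous_apply _))
  · exact continuous_const

theorem continuous_torusWeight (q : Polynomial ℝ) (N : ℕ) :
    Continuous fun θ : UnitAddTorus (DyadicIndex m) => torusWeight q θ N := by
  induction N using Nat.strong_induction_on with
  | _ N ih =>
    by_cases hN : N ≤ 1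
    · simpa only [torusWeight, treeWeight_of_le_one _ hN] using continuous_const
    · have h := ih (N / 2) (by omega)
      have h' : Continuous fun θ : UnitAddTorus (DyadicIndex m) =>
          q.eval (torusCoord θ (N / 2)).re :=
        q.continuous.comp (Complex.continuous_re.comp (continuous_torusCoord _))
      simp only [torusWeight, treeWeight_of_one_lt _ (not_le.1 hN)] at h ⊢
      split_ifs
      · exact h.mul h'
      · exact h.mul (continuous_const.sub h')

theorem eval_re_torusCoord_mem (hq : ∀ x ∈ Set.Icc (-1 : ℝ) 1, q.eval x ∈ Set.Icc (0 : ℝ) 1)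
    (θ : UnitAddTorus (DyadicIndex m)) (N : ℕ) :
    q.eval (torusCoord θ N).re ∈ Set.Icc (0 : ℝ) 1 :=
  hq _ (abs_le.1 (abs_re_torusCoord_le θ N))

theorem torusWeight_nonneg (hq : ∀ x ∈ Set.Icc (-1 : ℝ) 1, q.eval x ∈ Set.Icc (0 : ℝ) 1)
    (θ : UnitAddTorus (DyadicIndex m)) (N : ℕ) : 0 ≤ torusWeight q θ N :=
  treeWeight_nonneg (fun M => (eval_re_torusCoord_mem hq θ M).1)
    (fun M => (eval_re_torusCoord_mem hq θ M).2) N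

theorem torusWeight_le_one (hq : ∀ x ∈ Set.Icc (-1 : ℝ) 1, q.eval x ∈ Set.Icc (0 : ℝ) 1)
    (θ : UnitAddTorus (DyadicIndex m)) (N : ℕ) : torusWeight q θ N ≤ 1 :=
  treeWeight_le_one (fun M => (eval_re_torusCoord_mem hq θ M).1)
    (fun M => (eval_re_torusCoord_mem hq θ M).2) N

theorem torusCoord_add_single_self (hN : N ∈ Set.Ico 1 (2 ^ m)) (s : UnitAddCircle) :
    torusCoord (θ + Pi.single ⟨N, hN⟩ s) N = torusCoord θ N * s.toCircle := by
  simp only [torusCoord, dif_pos hN, Pi.add_apply, Pi.single_eq_same, AddCircle.toCircle_add,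
    Circle.coe_mul]

theorem torusCoord_add_single_of_ne (hN : N ∈ Set.Ico 1 (2 ^ m)) (s : UnitAddCircle)
    (h : M ≠ N) : torusCoord (θ + Pi.single ⟨N, hN⟩ s) M = torusCoord θ M := by
  unfold torusCoord
  split_ifs with hM
  · rw [Pi.add_apply, Pi.single_eq_of_ne (by simpa using h), add_zero]
  · rfl

/-- The case `M = N` expresses the independence of the weight of `N` from its own coordinate. -/
theorem torusWeight_add_single (hN : N ∈ Set.Ico 1 (2 ^ m)) (s : UnitAddCircle) (h : M ≤ N) :
    torusWeight q (θ + Pi.single ⟨N, hN⟩ s) M = torusWeight q θ M :=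
  treeWeight_congr fun K _ hK => by rw [torusCoord_add_single_of_ne hN s (by omega)]

/-! ### Moments of the random tree under an invariant probability measure -/

variable {μ : Measure (UnitAddTorus (DyadicIndex m))} [IsProbabilityMeasure μ]
  [μ.IsAddRightInvariant]

/-- If a translation fixes `H` and `b` and changes the sign of `u`, then
`∫ H exp (b u - b² / 2) ≤ ∫ H`. -/
theorem integral_mul_exp_le {G : Type*} [AddGroup G] [MeasurableSpace G] [MeasurableAdd G]
    {μ : Measure G} [μ.IsAddRightInvariant] {H b u : G → ℝ} {h : G}
    (hH0 : ∀ x, 0 ≤ H x) (hu : ∀ x, |u x| ≤ 1)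
    (hHh : ∀ x, H (x + h) = H x) (hbh : ∀ x, b (x + h) = b x) (huh : ∀ x, u (x + h) = -u x)
    (hi : Integrable H μ)
    (hi1 : Integrable (fun x => H x * Real.exp (b x * u x - b x ^ 2 / 2)) μ) :
    ∫ x, H x * Real.exp (b x * u x - b x ^ 2 / 2) ∂μ ≤ ∫ x, H x ∂μ := by
  have h1 : ∀ x, H (x + h) * Real.exp (b (x + h) * u (x + h) - b (x + h) ^ 2 / 2) =
      H x * Real.exp (-(b x * u x) - b x ^ 2 / 2) := fun x => by
    rw [hHh, hbh, huh, mul_neg]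
  have h2 : ∫ x, H x * Real.exp (-(b x * u x) - b x ^ 2 / 2) ∂μ =
      ∫ x, H x * Real.exp (b x * u x - b x ^ 2 / 2) ∂μ := by
    rw [← integral_add_right_eq_self (fun x => H x * Real.exp (b x * u x - b x ^ 2 / 2)) h]
    exact integral_congr_ae (Filter.Eventually.of_forall fun x => (h1 x).symm)
  have hi2 : Integrable (fun x => H x * Real.exp (-(b x * u x) - b x ^ 2 / 2)) μ :=
    (hi1.comp_add_right h).congr (Filter.Eventually.of_forall h1)
  -- Averaging over the translation turns `exp (b u)` into `cosh (b u)`, which is at most `exp (b ^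
  -- 2 / 2)` because `|u| ≤ 1`.
  have h3 : ∫ x, (H x * Real.exp (b x * u x - b x ^ 2 / 2) +
      H x * Real.exp (-(b x * u x) - b x ^ 2 / 2)) ∂μ ≤ ∫ x, 2 * H x ∂μ := by
    refine integral_mono (hi1.add hi2) (hi.const_mul 2) fun x => ?_
    have hc := Real.cosh_le_exp_half_sq (b x * u x)
    have hs : (b x * u x) ^ 2 / 2 ≤ b x ^ 2 / 2 := by
      have := (sq_le_one_iff_abs_le_one (u x)).2 (hu x)
      rw [mul_pow]
      nlinarith [sq_nonneg (b x)]
    have hc' := hc.trans (Real.exp_le_exp.2 hs)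
    have e : ∀ y, Real.exp (y - b x ^ 2 / 2) = Real.exp y * Real.exp (-(b x ^ 2 / 2)) :=
      fun y => by rw [sub_eq_add_neg, Real.exp_add]
    have hk : Real.cosh (b x * u x) * Real.exp (-(b x ^ 2 / 2)) ≤ 1 := by
      calc _ ≤ Real.exp (b x ^ 2 / 2) * Real.exp (-(b x ^ 2 / 2)) := by gcongr
        _ = 1 := by rw [← Real.exp_add, add_neg_cancel, Real.exp_zero]
    rw [Real.cosh_eq] at hk
    change H x * _ + H x * _ ≤ 2 * H x
    rw [e, e]
    nlinarith [hH0 x]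
  rw [integral_add hi1 hi2, h2, integral_const_mul] at h3
  linarith

/-- Exponential supermartingale: the last factor is peeled off by a half turn of coordinate `K`,
which fixes all earlier factors and the weight of `K`. The factor `κ` selects a direction in the
plane. -/
theorem integral_exp_sum_sub_le (q : Polynomial ℝ) {κ : ℂ} (hκ : ‖κ‖ ≤ 1) (t : ℝ) {K : ℕ}
    (hK1 : 1 ≤ K) (hK : K ≤ 2 ^ m) :
    ∫ θ, Real.exp (∑ N ∈ Finset.Ico 1 K, (t * torusWeight q θ N * (κ * torusCoord θ N).re -
      (t * torusWeight q θ N) ^ 2 / 2)) ∂μ ≤ 1 := by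
  have hcont : ∀ K, Continuous fun θ : UnitAddTorus (DyadicIndex m) =>
      Real.exp (∑ N ∈ Finset.Ico 1 K, (t * torusWeight q θ N * (κ * torusCoord θ N).re -
        (t * torusWeight q θ N) ^ 2 / 2)) := fun K => by
    refine Real.continuous_exp.comp (continuous_finsetSum _ fun N _ => ?_)
    have h1 := continuous_torusWeight (m := m) q N
    have h2 := continuous_torusCoord (m := m) N
    fun_prop
  induction K, hK1 using Nat.le_induction with
  | base => simp
  | succ K hK1 ih =>
    refine le_trans ?_ (ih (by omega))
    have hmem : K ∈ Set.Ico 1 (2 ^ m) := ⟨hK1, by omega⟩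
    have hsplit : ∀ θ : UnitAddTorus (DyadicIndex m),
        Real.exp (∑ N ∈ Finset.Ico 1 (K + 1), (t * torusWeight q θ N * (κ * torusCoord θ N).re -
          (t * torusWeight q θ N) ^ 2 / 2)) =
        Real.exp (∑ N ∈ Finset.Ico 1 K, (t * torusWeight q θ N * (κ * torusCoord θ N).re -
          (t * torusWeight q θ N) ^ 2 / 2)) *
        Real.exp (t * torusWeight q θ K * (κ * torusCoord θ K).re -
          (t * torusWeight q θ K) ^ 2 / 2) := fun θ => by
      rw [Finset.sum_Ico_succ_top hK1, Real.exp_add]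
    have hi := (hcont (K + 1)).integrable_of_compactSpace μ
    simp only [hsplit] at hi ⊢
    refine integral_mul_exp_le (b := fun θ => t * torusWeight q θ K)
      (u := fun θ => (κ * torusCoord θ K).re)
      (h := Pi.single ⟨K, hmem⟩ ((1 / 2 : ℝ) : UnitAddCircle))
      (fun θ => (Real.exp_pos _).le) (fun θ => ?_) (fun θ => ?_) (fun θ => ?_) (fun θ => ?_)
      ((hcont K).integrable_of_compactSpace μ) hi
    · refine (Complex.abs_re_le_norm _).trans ?_
      rw [norm_mul, norm_torusCoord, mul_one]
      exact hκ
    · congr 1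
      refine Finset.sum_congr rfl fun N hN => ?_
      have hN := (Finset.mem_Ico.1 hN).2
      rw [torusWeight_add_single _ _ hN.le, torusCoord_add_single_of_ne _ _ hN.ne]
    · rw [torusWeight_add_single _ _ le_rfl]
    · rw [torusCoord_add_single_self, UnitAddCircle.toCircle_half]
      simp

theorem integral_exp_re_sum_le (hq : ∀ x ∈ Set.Icc (-1 : ℝ) 1, q.eval x ∈ Set.Icc (0 : ℝ) 1)
    {κ : ℂ} (hκ : ‖κ‖ ≤ 1) (t : ℝ) :
    ∫ θ, Real.exp (t * (κ * ∑ N ∈ Finset.Ico 1 (2 ^ m),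
      (torusWeight q θ N : ℂ) * torusCoord θ N).re) ∂μ ≤ Real.exp (t ^ 2 * m / 2) := by
  have key := integral_exp_sum_sub_le (μ := μ) q hκ t Nat.one_le_two_pow le_rfl
  have hle : ∀ θ : UnitAddTorus (DyadicIndex m),
      Real.exp (t * (κ * ∑ N ∈ Finset.Ico 1 (2 ^ m),
        (torusWeight q θ N : ℂ) * torusCoord θ N).re) ≤
      Real.exp (t ^ 2 * m / 2) *
      Real.exp (∑ N ∈ Finset.Ico 1 (2 ^ m), (t * torusWeight q θ N * (κ * torusCoord θ N).re -
        (t * torusWeight q θ N) ^ 2 / 2)) := fun θ => by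
    rw [← Real.exp_add, Real.exp_le_exp, Finset.sum_sub_distrib]
    have e1 : t * (κ * ∑ N ∈ Finset.Ico 1 (2 ^ m),
        (torusWeight q θ N : ℂ) * torusCoord θ N).re =
        ∑ N ∈ Finset.Ico 1 (2 ^ m), t * torusWeight q θ N * (κ * torusCoord θ N).re := by
      rw [Finset.mul_sum, Complex.re_sum, Finset.mul_sum]
      refine Finset.sum_congr rfl fun N _ => ?_
      rw [mul_left_comm κ, Complex.re_ofReal_mul, mul_assoc]
    -- The quadratic variation is bounded surely: weights lie in `[0, 1]`, so their squares sum to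
    -- at most their sum, `m`.
    have e2 : ∑ N ∈ Finset.Ico 1 (2 ^ m), (t * torusWeight q θ N) ^ 2 / 2 ≤ t ^ 2 * m / 2 := by
      have : (m : ℝ) = ∑ N ∈ Finset.Ico 1 (2 ^ m), torusWeight q θ N :=
        (sum_treeWeight _ m).symm
      rw [this, Finset.mul_sum, Finset.sum_div]
      refine Finset.sum_le_sum fun N _ => ?_
      rw [mul_pow]
      have := torusWeight_nonneg hq θ N
      have := torusWeight_le_one hq θ N
      gcongr
      nlinarith
    linarith
  have hc : Continuous fun θ : UnitAddTorus (DyadicIndex m) =>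
      ∑ N ∈ Finset.Ico 1 (2 ^ m), (torusWeight q θ N : ℂ) * torusCoord θ N :=
    continuous_finsetSum _ fun N _ =>
      (Complex.continuous_ofReal.comp (continuous_torusWeight q N)).mul (continuous_torusCoord N)
  have hc2 : Continuous fun θ : UnitAddTorus (DyadicIndex m) =>
      Real.exp (∑ N ∈ Finset.Ico 1 (2 ^ m), (t * torusWeight q θ N * (κ * torusCoord θ N).re -
        (t * torusWeight q θ N) ^ 2 / 2)) := by
    refine Real.continuous_exp.comp (continuous_finsetSum _ fun N _ => ?_)
    have h1 := continuous_torusWeight (m := m) q N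
    have h2 := continuous_torusCoord (m := m) N
    fun_prop
  refine (integral_mono (Continuous.integrable_of_compactSpace (by fun_prop) μ)
    (Continuous.integrable_of_compactSpace (by fun_prop) μ) hle).trans ?_
  rw [integral_const_mul]
  exact mul_le_of_le_one_right (Real.exp_pos _).le key

theorem pow_even_le_factorial_mul_exp (y : ℝ) (p : ℕ) :
    y ^ (2 * p) ≤ (2 * p).factorial * (Real.exp y + Real.exp (-y)) := by
  have h : |y| ^ (2 * p) ≤ (2 * p).factorial * Real.exp |y| := by
    have := Real.pow_div_factorial_le_exp |y| (abs_nonneg y) (2 * p)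
    rwa [div_le_iff₀' (by positivity)] at this
  rw [pow_mul, sq_abs, ← pow_mul] at h
  refine h.trans ?_
  gcongr
  rcases abs_choice y with h | h <;> rw [h]
  · exact le_add_of_nonneg_right (Real.exp_pos _).le
  · exact le_add_of_nonneg_left (Real.exp_pos _).le

theorem norm_pow_even_le (z : ℂ) (p : ℕ) :
    ‖z‖ ^ (2 * p) ≤ 2 ^ (2 * p) * (z.re ^ (2 * p) + z.im ^ (2 * p)) := by
  have hz : ‖z‖ ≤ 2 * max |z.re| |z.im| := by
    refine (Complex.norm_le_abs_re_add_abs_im z).trans ?_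
    linarith [le_max_left |z.re| |z.im|, le_max_right |z.re| |z.im|]
  refine (pow_le_pow_left₀ (norm_nonneg z) hz _).trans ?_
  rw [mul_pow]
  gcongr
  have he : ∀ y : ℝ, |y| ^ (2 * p) = y ^ (2 * p) := fun y => by rw [pow_mul, sq_abs, ← pow_mul]
  have h0 : ∀ y : ℝ, 0 ≤ y ^ (2 * p) := fun y => by rw [pow_mul]; positivity
  rcases max_choice |z.re| |z.im| with h | h <;> rw [h, he]
  · exact le_add_of_nonneg_right (h0 _)
  · exact le_add_of_nonneg_left (h0 _)

/-- The `2 p`-th moment of the sum of all terms of the random tree. -/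
theorem integral_norm_sum_pow_le (hm : 1 ≤ m)
    (hq : ∀ x ∈ Set.Icc (-1 : ℝ) 1, q.eval x ∈ Set.Icc (0 : ℝ) 1) (p : ℕ) :
    ∫ θ, ‖∑ N ∈ Finset.Ico 1 (2 ^ m), (torusWeight q θ N : ℂ) * torusCoord θ N‖ ^ (2 * p) ∂μ ≤
      2 ^ (2 * p) * (2 * p).factorial * (4 * Real.exp (1 / 2)) * m ^ p := by
  have hc : Continuous fun θ : UnitAddTorus (DyadicIndex m) =>
      ∑ N ∈ Finset.Ico 1 (2 ^ m), (torusWeight q θ N : ℂ) * torusCoord θ N :=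
    continuous_finsetSum _ fun N _ =>
      (Complex.continuous_ofReal.comp (continuous_torusWeight q N)).mul (continuous_torusCoord N)
  have hm0 : (0 : ℝ) < m := by exact_mod_cast hm
  -- The choice `t = 1 / √m` makes the exponential moment bounded independently of `m`.
  have hE : ∀ κ : ℂ, ‖κ‖ ≤ 1 →
      ∫ θ, Real.exp ((√m)⁻¹ * (κ * ∑ N ∈ Finset.Ico 1 (2 ^ m),
        (torusWeight q θ N : ℂ) * torusCoord θ N).re) ∂μ ≤ Real.exp (1 / 2) := fun κ hκ => by
    refine (integral_exp_re_sum_le hq hκ _).trans_eq ?_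
    rw [inv_pow, Real.sq_sqrt hm0.le, inv_mul_cancel₀ hm0.ne']
  set F : UnitAddTorus (DyadicIndex m) → ℂ := fun θ =>
    ∑ N ∈ Finset.Ico 1 (2 ^ m), (torusWeight q θ N : ℂ) * torusCoord θ N with hF
  change ∀ κ : ℂ, ‖κ‖ ≤ 1 → ∫ θ, Real.exp ((√m)⁻¹ * (κ * F θ).re) ∂μ ≤ _ at hE
  change ∫ θ, ‖F θ‖ ^ (2 * p) ∂μ ≤ _
  set C : ℝ := 2 ^ (2 * p) * (2 * p).factorial * m ^ p with hC
  have hpt : ∀ θ, ‖F θ‖ ^ (2 * p) ≤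
      C * (Real.exp ((√m)⁻¹ * ((1 : ℂ) * F θ).re) + Real.exp ((√m)⁻¹ * ((-1 : ℂ) * F θ).re) +
        (Real.exp ((√m)⁻¹ * (-Complex.I * F θ).re) +
          Real.exp ((√m)⁻¹ * (Complex.I * F θ).re))) := fun θ => by
    have hs : ∀ y : ℝ, y ^ (2 * p) ≤ (2 * p).factorial * m ^ p *
        (Real.exp ((√m)⁻¹ * y) + Real.exp (-((√m)⁻¹ * y))) := fun y => by
      have := pow_even_le_factorial_mul_exp ((√m)⁻¹ * y) p
      rw [mul_pow, inv_pow, pow_mul (√m), Real.sq_sqrt hm0.le, inv_mul_le_iff₀ (by positivity)]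
        at this
      refine this.trans_eq (by ring)
    refine (norm_pow_even_le (F θ) p).trans ?_
    have h1 := hs (F θ).re
    have h2 := hs (F θ).im
    have e1 : ((1 : ℂ) * F θ).re = (F θ).re := by simp
    have e2 : ((-1 : ℂ) * F θ).re = -(F θ).re := by simp
    have e3 : (-Complex.I * F θ).re = (F θ).im := by simp
    have e4 : (Complex.I * F θ).re = -(F θ).im := by simp
    rw [e1, e2, e3, e4, mul_neg, mul_neg, hC]
    refine (mul_le_mul_of_nonneg_left (add_le_add h1 h2) (by positivity)).trans_eq ?_
    ring
  have hi : ∀ κ : ℂ, Integrable (fun θ => Real.exp ((√m)⁻¹ * (κ * F θ).re)) μ := fun κ =>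
    Continuous.integrable_of_compactSpace (by fun_prop) μ
  have hi2 : ∀ κ κ' : ℂ, Integrable (fun θ => Real.exp ((√m)⁻¹ * (κ * F θ).re) +
      Real.exp ((√m)⁻¹ * (κ' * F θ).re)) μ := fun κ κ' => (hi κ).add (hi κ')
  refine (integral_mono (Continuous.integrable_of_compactSpace (by fun_prop) μ)
    (((hi2 1 (-1)).add (hi2 (-Complex.I) Complex.I)).const_mul C) hpt).trans ?_
  rw [integral_const_mul]
  have hadd : ∫ θ, (Real.exp ((√m)⁻¹ * ((1 : ℂ) * F θ).re) +
      Real.exp ((√m)⁻¹ * ((-1 : ℂ) * F θ).re) + (Real.exp ((√m)⁻¹ * (-Complex.I * F θ).re) +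
        Real.exp ((√m)⁻¹ * (Complex.I * F θ).re))) ∂μ ≤ 4 * Real.exp (1 / 2) := by
    rw [integral_add (hi2 1 (-1)) (hi2 (-Complex.I) Complex.I),
      integral_add (hi 1) (hi (-1)), integral_add (hi (-Complex.I)) (hi Complex.I)]
    have := hE 1 (by simp)
    have := hE (-1) (by simp)
    have := hE (-Complex.I) (by simp)
    have := hE Complex.I (by simp)
    linarith
  calc _ ≤ C * (4 * Real.exp (1 / 2)) := by
        refine mul_le_mul_of_nonneg_left hadd ?_
        positivity
    _ = _ := by rw [hC]; ring

/-- The expected weighted sum of the positive parts `(Re z_N)⁺` is at least `m / 4`. -/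
theorem le_integral_sum_posPart
    (hq : ∀ x ∈ Set.Icc (-1 : ℝ) 1, q.eval x ∈ Set.Icc (0 : ℝ) 1) :
    (m / 4 : ℝ) ≤
      ∫ θ, ∑ N ∈ Finset.Ico 1 (2 ^ m), torusWeight q θ N * max (torusCoord θ N).re 0 ∂μ := by
  have hw := continuous_torusWeight (m := m) q
  have hz := continuous_torusCoord (m := m)
  have hterm : ∀ N ∈ Finset.Ico 1 (2 ^ m),
      (∫ θ, torusWeight q θ N ∂μ) / 4 ≤ ∫ θ, torusWeight q θ N * max (torusCoord θ N).re 0 ∂μ := by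
    intro N hN
    have hN : N ∈ Set.Ico 1 (2 ^ m) := by simpa using hN
    have hwN := hw N
    have hzN := hz N
    -- A quarter turn exchanges the squares of the real and imaginary parts, so each carries half of
    -- the expected weight.
    have hq4 : ∫ θ, torusWeight q θ N * (torusCoord θ N).im ^ 2 ∂μ =
        ∫ θ, torusWeight q θ N * (torusCoord θ N).re ^ 2 ∂μ := by
      rw [← integral_add_right_eq_self (fun θ => torusWeight q θ N * (torusCoord θ N).re ^ 2)
        (Pi.single ⟨N, hN⟩ ((1 / 4 : ℝ) : UnitAddCircle))]
      refine integral_congr_ae (Filter.Eventually.of_forall fun θ => ?_)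
      simp only
      rw [torusWeight_add_single _ _ le_rfl, torusCoord_add_single_self,
        UnitAddCircle.toCircle_quarter]
      simp
    have hq2 : ∫ θ, torusWeight q θ N * max (-(torusCoord θ N).re) 0 ∂μ =
        ∫ θ, torusWeight q θ N * max (torusCoord θ N).re 0 ∂μ := by
      rw [← integral_add_right_eq_self (fun θ => torusWeight q θ N * max (torusCoord θ N).re 0)
        (Pi.single ⟨N, hN⟩ ((1 / 2 : ℝ) : UnitAddCircle))]
      refine integral_congr_ae (Filter.Eventually.of_forall fun θ => ?_)
      simp only
      rw [torusWeight_add_single _ _ le_rfl, torusCoord_add_single_self,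
        UnitAddCircle.toCircle_half]
      simp
    have hsq : ∫ θ, torusWeight q θ N ∂μ =
        ∫ θ, torusWeight q θ N * (torusCoord θ N).re ^ 2 ∂μ +
        ∫ θ, torusWeight q θ N * (torusCoord θ N).im ^ 2 ∂μ := by
      rw [← integral_add (Continuous.integrable_of_compactSpace (by fun_prop) μ)
        (Continuous.integrable_of_compactSpace (by fun_prop) μ)]
      refine integral_congr_ae (Filter.Eventually.of_forall fun θ => ?_)
      have h1 : (torusCoord θ N).re ^ 2 + (torusCoord θ N).im ^ 2 = 1 := by
        have h := Complex.sq_norm (torusCoord θ N)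
        rw [norm_torusCoord, Complex.normSq_apply] at h
        linarith
      simp only
      rw [← mul_add, h1, mul_one]
    -- Here `x ^ 2 ≤ |x| = x⁺ + x⁻` on `[-1, 1]`; the two parts have equal integrals by the half
    -- turn, which halves the bound once more.
    have hle : ∫ θ, torusWeight q θ N * (torusCoord θ N).re ^ 2 ∂μ ≤
        ∫ θ, torusWeight q θ N * max (torusCoord θ N).re 0 ∂μ +
        ∫ θ, torusWeight q θ N * max (-(torusCoord θ N).re) 0 ∂μ := by
      rw [← integral_add (Continuous.integrable_of_compactSpace (by fun_prop) μ)
        (Continuous.integrable_of_compactSpace (by fun_prop) μ)]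
      refine integral_mono (Continuous.integrable_of_compactSpace (by fun_prop) μ)
        (Continuous.integrable_of_compactSpace (by fun_prop) μ) fun θ => ?_
      simp only
      rw [← mul_add]
      refine mul_le_mul_of_nonneg_left ?_ (torusWeight_nonneg hq θ N)
      obtain ⟨h1, h2⟩ := abs_le.1 (abs_re_torusCoord_le θ N)
      rcases le_total 0 (torusCoord θ N).re with h | h
      · rw [max_eq_left h, max_eq_right (by linarith)]; nlinarith
      · rw [max_eq_right h, max_eq_left (by linarith)]; nlinarith
    linarith
  rw [integral_finsetSum _ fun N _ => ?_]
  · refine le_trans ?_ (Finset.sum_le_sum hterm)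
    rw [← Finset.sum_div, ← integral_finsetSum _ fun N _ => (hw N).integrable_of_compactSpace μ]
    simp only [torusWeight, sum_treeWeight]
    simp
  · have hwN := hw N
    have hzN := hz N
    exact Continuous.integrable_of_compactSpace (by fun_prop) μ

end Torus

/-! ### Polynomial approximation of the sign and the maximal partial sum -/

/-- A polynomial with values in `[0, 1]` which is close to `1` on `[δ, 1]` and close to `0` on
`[-1, -δ]`. -/
theorem exists_polynomial_near_step {δ ε : ℝ} (hδ : 0 < δ) (hε : 0 < ε) (hε1 : ε ≤ 1) :
    ∃ q : Polynomial ℝ, (∀ x ∈ Set.Icc (-1 : ℝ) 1, q.eval x ∈ Set.Icc (0 : ℝ) 1) ∧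
      (∀ x ∈ Set.Icc (-1 : ℝ) 1, δ ≤ x → 1 - ε ≤ q.eval x) ∧
      (∀ x ∈ Set.Icc (-1 : ℝ) 1, x ≤ -δ → q.eval x ≤ ε) := by
  set r : ℝ → ℝ := fun x => max 0 (min 1 ((x / δ + 1) / 2)) with hr
  have hr0 : ∀ x, 0 ≤ r x := fun x => le_max_left _ _
  have hr1 : ∀ x, r x ≤ 1 := fun x => max_le zero_le_one (min_le_left _ _)
  -- The ramp is squeezed into `[ε / 2, 1 - ε / 2]`, so an approximation within `ε / 2` still has
  -- values in `[0, 1]`.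
  have hcont : Continuous fun x => ε / 2 + (1 - ε) * r x := by
    rw [hr]; fun_prop
  obtain ⟨q, hq⟩ := exists_polynomial_near_of_continuousOn (-1) 1 _ hcont.continuousOn
    (ε / 2) (by positivity)
  refine ⟨q, fun x hx => ?_, fun x hx hxδ => ?_, fun x hx hxδ => ?_⟩
  · obtain ⟨h1, h2⟩ := abs_lt.1 (hq x hx)
    constructor <;> nlinarith [hr0 x, hr1 x]
  · have : r x = 1 := by
      have : 1 ≤ x / δ := (one_le_div hδ).2 hxδ
      rw [hr]
      simp only
      rw [min_eq_left (by linarith), max_eq_right zero_le_one]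
    obtain ⟨h1, h2⟩ := abs_lt.1 (hq x hx)
    rw [this] at h1
    linarith
  · have : r x = 0 := by
      have : x / δ ≤ -1 := by rw [div_le_iff₀ hδ]; linarith
      rw [hr]
      simp only
      rw [min_eq_right (by linarith), max_eq_left (by linarith)]
    obtain ⟨h1, h2⟩ := abs_lt.1 (hq x hx)
    rw [this] at h2
    linarith

/-- Continuity from above along the sets `|g| < 1 / (n + 1)`, which decrease to the zero set. -/
theorem exists_measureReal_abs_lt_le {X : Type*} [MeasurableSpace X] {μ : Measure X}
    [IsFiniteMeasure μ] {g : X → ℝ} (hg : Measurable g) (h0 : μ {x | g x = 0} = 0) {η : ℝ}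
    (hη : 0 < η) : ∃ δ > 0, μ.real {x | |g x| < δ} ≤ η := by
  set s : ℕ → Set X := fun n => {x | |g x| < 1 / ((n : ℝ) + 1)} with hs
  have hinter : ⋂ n, s n = {x | g x = 0} := by
    ext x
    simp only [hs, Set.mem_iInter, Set.mem_ofPred_eq]
    refine ⟨fun h => ?_, fun h n => by rw [h, abs_zero]; positivity⟩
    by_contra hx
    obtain ⟨n, hn⟩ := exists_nat_one_div_lt (abs_pos.2 hx)
    exact (hn.trans (h n)).false
  have hanti : Antitone s := fun a b hab x hx =>
    lt_of_lt_of_le hx.out (Nat.one_div_le_one_div hab)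
  have ht := tendsto_measure_iInter_atTop (μ := μ) (s := s)
    (fun n => (measurableSet_lt hg.abs measurable_const).nullMeasurableSet) hanti
    ⟨0, measure_ne_top _ _⟩
  rw [hinter, h0] at ht
  obtain ⟨n, hn⟩ := ((tendsto_order.1 ht).2 (ENNReal.ofReal η) (by simpa using hη)).exists
  exact ⟨1 / ((n : ℝ) + 1), by positivity, ENNReal.toReal_le_of_le_ofReal hη.le hn.le⟩

theorem haarAddCircle_re_toCircle_eq_zero :
    (AddCircle.haarAddCircle : Measure UnitAddCircle)
      {x | (AddCircle.toCircle x : ℂ).re = 0} = 0 := by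
  have hvol : (volume : Measure UnitAddCircle) = AddCircle.haarAddCircle := by
    rw [AddCircle.volume_eq_smul_haarAddCircle, ENNReal.ofReal_one, one_smul]
  have hatom : NullSingletonClass (volume : Measure UnitAddCircle) := ⟨fun x => by
    rw [← Metric.closedBall_zero, AddCircle.volume_closedBall]
    simp⟩
  rw [← hvol]
  refine Set.Finite.measure_zero ?_ _
  have hinj : Function.Injective fun x : UnitAddCircle => (AddCircle.toCircle x : ℂ) :=
    Circle.coe_injective.comp (AddCircle.injective_toCircle one_ne_zero)
  refine Set.Finite.subset (Set.Finite.preimage hinj.injOn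
    (Set.toFinite ({Complex.I, -Complex.I} : Set ℂ))) fun x hx => ?_
  have h := Complex.sq_norm (AddCircle.toCircle x : ℂ)
  rw [Circle.norm_coe, Complex.normSq_apply, hx.out] at h
  have h' : (AddCircle.toCircle x : ℂ).im * (AddCircle.toCircle x : ℂ).im = 1 := by linarith
  rcases mul_self_eq_one_iff.1 h' with h1 | h1
  · exact Or.inl (Complex.ext (by simpa using hx.out) (by simpa using h1))
  · exact Or.inr (Complex.ext (by simpa using hx.out) (by simpa using h1))

/-- The probability Haar measure on a torus. -/
noncomputable abbrev torusHaar (d : Type*) [Fintype d] : Measure (UnitAddTorus d) :=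
  Measure.pi fun _ => AddCircle.haarAddCircle

theorem exists_torusHaar_abs_re_torusCoord_lt_le (m : ℕ) {η : ℝ} (hη : 0 < η) :
    ∃ δ > 0, ∀ N ∈ Finset.Ico 1 (2 ^ m),
      (torusHaar (DyadicIndex m)).real {θ | |(torusCoord θ N).re| < δ} ≤ η := by
  have hmeas : Measurable fun x : UnitAddCircle => (AddCircle.toCircle x : ℂ).re :=
    (Complex.continuous_re.comp (continuous_subtype_val.comp
      AddCircle.continuous_toCircle)).measurable
  obtain ⟨δ, hδ, h⟩ := exists_measureReal_abs_lt_le hmeas haarAddCircle_re_toCircle_eq_zero hη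
  refine ⟨δ, hδ, fun N hN => le_trans (le_of_eq ?_) h⟩
  have hN : N ∈ Set.Ico 1 (2 ^ m) := by simpa using hN
  have hmp := measurePreserving_eval
    (fun _ : DyadicIndex m => (AddCircle.haarAddCircle : Measure UnitAddCircle)) ⟨N, hN⟩
  rw [Measure.real, Measure.real, ← hmp.measure_preimage
    (measurableSet_lt hmeas.abs measurable_const).nullMeasurableSet]
  simp only [torusCoord, dif_pos hN, Set.preimage_ofPred_eq, Function.eval]

/-- The largest partial sum, in the order of the dyadic points, of the random tree. -/
noncomputable def torusMax {m : ℕ} (q : Polynomial ℝ) (θ : UnitAddTorus (DyadicIndex m)) : ℝ :=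
  ⨆ l : DyadicIndex m, ‖∑ N ∈ Finset.univ.filter (fun N => N ≤ l),
    (torusWeight q θ (dyadicPerm m N) : ℂ) * torusCoord θ (dyadicPerm m N)‖

theorem continuous_torusMax {m : ℕ} (hm : 1 ≤ m) (q : Polynomial ℝ) :
    Continuous fun θ : UnitAddTorus (DyadicIndex m) => torusMax q θ := by
  have : Nonempty (DyadicIndex m) := ⟨1, le_rfl, Nat.one_lt_two_pow (by omega)⟩
  unfold torusMax
  simp only [← Finset.sup'_univ_eq_ciSup]
  refine Continuous.finset_sup'_apply _ fun l _ => Continuous.norm ?_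
  exact continuous_finsetSum _ fun N _ =>
    (Complex.continuous_ofReal.comp (continuous_torusWeight q _)).mul (continuous_torusCoord _)

theorem sum_Ico_eq_sum_dyadicIndex {E : Type*} [AddCommMonoid E] (m : ℕ) (g : ℕ → E) :
    ∑ N ∈ Finset.Ico 1 (2 ^ m), g N = ∑ N : DyadicIndex m, g N :=
  Finset.sum_subtype _ (fun x => by simp) g

/-- For a suitable polynomial, the largest partial sum exceeds `m / 16` with a probability bounded
below; this is stated in terms of a continuous function vanishing where `torusMax ≤ m / 16`. -/
theorem exists_polynomial_le_integral_torusMax {m : ℕ} (hm : 1 ≤ m) :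
    ∃ q : Polynomial ℝ, (∀ x ∈ Set.Icc (-1 : ℝ) 1, q.eval x ∈ Set.Icc (0 : ℝ) 1) ∧
      3 / 32 ≤ ∫ θ, max 0 (min 1 (16 / m * torusMax q θ - 1)) ∂torusHaar (DyadicIndex m) := by
  have hm0 : (0 : ℝ) < m := by exact_mod_cast hm
  have hm1 : (1 : ℝ) ≤ m := by exact_mod_cast hm
  -- This `η` makes the union bound over fewer than `2 ^ m` indices at most `1 / 32`; the `ε` below
  -- makes the total error `m * (m * ε)` equal to `m / 16`.
  obtain ⟨δ, hδ, hbad⟩ := exists_torusHaar_abs_re_torusCoord_lt_le m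
    (η := 1 / (32 * 2 ^ m)) (by positivity)
  set ε : ℝ := 1 / (16 * m) with hε
  have hε0 : 0 < ε := by positivity
  obtain ⟨q, hq, hq1, hq2⟩ := exists_polynomial_near_step hδ hε0
    (by rw [hε, div_le_one (by positivity)]; linarith)
  refine ⟨q, hq, ?_⟩
  set B : Set (UnitAddTorus (DyadicIndex m)) :=
    ⋃ N ∈ Finset.Ico 1 (2 ^ m), {θ | |(torusCoord θ N).re| < δ} with hB
  have hBm : MeasurableSet B := by
    refine Finset.measurableSet_biUnion _ fun N _ => ?_
    exact (isOpen_lt (Complex.continuous_re.comp (continuous_torusCoord N)).abs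
      continuous_const).measurableSet
  have hBle : (torusHaar (DyadicIndex m)).real B ≤ 1 / 32 := by
    refine (measureReal_biUnion_finset_le _ _).trans ((Finset.sum_le_sum hbad).trans ?_)
    rw [Finset.sum_const, Nat.card_Ico, nsmul_eq_mul, Nat.cast_sub Nat.one_le_two_pow]
    push_cast
    have : (0 : ℝ) < 2 ^ m := by positivity
    rw [mul_one_div, div_le_div_iff₀ (by positivity) (by norm_num)]
    linarith
  set T : UnitAddTorus (DyadicIndex m) → ℝ := fun θ =>
    ∑ N ∈ Finset.Ico 1 (2 ^ m), torusWeight q θ N * max (torusCoord θ N).re 0 with hT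
  have hTE : (m / 4 : ℝ) ≤ ∫ θ, T θ ∂torusHaar (DyadicIndex m) := le_integral_sum_posPart hq
  have hTcont : Continuous T := by
    refine continuous_finsetSum _ fun N _ => ?_
    have h1 := continuous_torusWeight (m := m) q N
    have h2 := continuous_torusCoord (m := m) N
    fun_prop
  have hTm : ∀ θ, T θ ≤ m := fun θ => by
    rw [← sum_treeWeight (fun M => q.eval (torusCoord θ M).re) m]
    refine Finset.sum_le_sum fun N _ => mul_le_of_le_one_right (torusWeight_nonneg hq θ N) ?_
    exact max_le (abs_le.1 (abs_re_torusCoord_le θ N)).2 zero_le_one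
  have hmain : ∀ θ ∉ B, T θ - m / 16 ≤ torusMax q θ := fun θ hθ => by
    have hθ' : ∀ N, 1 ≤ N → N < 2 ^ m → δ ≤ |(torusCoord θ N).re| := fun N h1 h2 => by
      by_contra h
      exact hθ (Set.mem_biUnion (Finset.mem_coe.2 (Finset.mem_Ico.2 ⟨h1, h2⟩)) (not_le.1 h))
    have hmem : ∀ N, (torusCoord θ N).re ∈ Set.Icc (-1 : ℝ) 1 := fun N =>
      abs_le.1 (abs_re_torusCoord_le θ N)
    obtain ⟨τ, hτ⟩ := exists_threshold_sum_ge (a := fun N => q.eval (torusCoord θ N).re)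
      (c := fun N => (torusCoord θ N).re) (m := m) hε0.le
      (fun N => (eval_re_torusCoord_mem hq θ N).1) (fun N => (eval_re_torusCoord_mem hq θ N).2)
      (fun N => abs_re_torusCoord_le θ N)
      (fun N h1 h2 h => hq1 _ (hmem N) (by have := hθ' N h1 h2; rwa [abs_of_pos h] at this))
      (fun N h1 h2 h => hq2 _ (hmem N) (by
        have := hθ' N h1 h2
        rw [abs_of_nonpos (not_lt.1 h)] at this
        linarith))
    have hmε : (m * (m * ε) : ℝ) = m / 16 := by rw [hε]; field_simp
    rw [hmε] at hτ
    refine hτ.trans (le_trans ?_ (norm_sum_threshold_le_iSup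
      (fun N => (torusWeight q θ N : ℂ) * torusCoord θ N) τ))
    refine le_trans (le_of_eq ?_) (Complex.re_le_norm _)
    rw [sum_Ico_eq_sum_dyadicIndex, Complex.re_sum]
    refine Finset.sum_congr rfl fun N _ => ?_
    split_ifs
    · rw [Complex.re_ofReal_mul]; rfl
    · rfl
  -- Off `B` the cutoff argument is at least `16 y - 2` with `y = T θ / m ≤ 1`, and `16 y - 2 ≥ y -
  -- 1 / 8` once `y ≥ 1 / 8`. Integrating gives `1 / 4 - 1 / 8 - 1 / 32 = 3 / 32`.
  have hpt : ∀ θ, T θ / m - 1 / 8 - B.indicator 1 θ ≤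
      max 0 (min 1 (16 / m * torusMax q θ - 1)) := fun θ => by
    have hy1 : T θ / m ≤ 1 := (div_le_one hm0).2 (hTm θ)
    by_cases hθ : θ ∈ B
    · rw [Set.indicator_of_mem hθ, Pi.one_apply]
      exact le_max_of_le_left (by linarith)
    · rw [Set.indicator_of_notMem hθ]
      have h1 : 16 * (T θ / m) - 2 ≤ 16 / m * torusMax q θ - 1 := by
        have := mul_le_mul_of_nonneg_left (hmain θ hθ) (show 0 ≤ 16 / (m : ℝ) by positivity)
        have e : 16 / (m : ℝ) * (T θ - m / 16) = 16 * (T θ / m) - 1 := by field_simp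
        linarith
      by_cases h8 : T θ / m < 1 / 8
      · exact le_max_of_le_left (by linarith)
      · exact le_max_of_le_right (le_min (by linarith) (by linarith))
  have hTi := hTcont.integrable_of_compactSpace (torusHaar (DyadicIndex m))
  have hBi : Integrable (B.indicator (1 : UnitAddTorus (DyadicIndex m) → ℝ))
      (torusHaar (DyadicIndex m)) := (integrable_indicator_iff hBm).2 (integrable_const 1).integrableOn
  have hTi2 : Integrable (fun θ => T θ / m - 1 / 8) (torusHaar (DyadicIndex m)) :=
    (hTi.div_const _).sub (integrable_const _)
  have hMcont := continuous_torusMax hm q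
  refine le_trans ?_ (integral_mono (f := fun θ => T θ / m - 1 / 8 - B.indicator 1 θ)
    (hTi2.sub hBi) (Continuous.integrable_of_compactSpace (by fun_prop) _) hpt)
  rw [integral_sub hTi2 hBi, integral_sub (hTi.div_const _) (integrable_const _),
    integral_div, integral_indicator_one hBm, integral_const, probReal_univ, one_smul]
  have : 1 / 4 ≤ (∫ θ, T θ ∂torusHaar (DyadicIndex m)) / m := by
    rw [le_div_iff₀ hm0]; linarith
  linarith

/-! ### Equidistribution on the torus along fast growing frequencies -/

section Equidistribution

open Filter Topology

variable {d : Type*} [Fintype d]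

/-- Moving a coordinate with `k i ≠ 0` by half a period of the character changes its sign. -/
theorem integral_mFourier_eq_zero {μ : Measure (UnitAddTorus d)} [μ.IsAddRightInvariant]
    {k : d → ℤ} (hk : k ≠ 0) : ∫ θ, UnitAddTorus.mFourier k θ ∂μ = 0 := by
  classical
  obtain ⟨i, hi⟩ := Function.ne_iff.1 hk
  refine integral_eq_zero_of_add_right_eq_neg
    (g := Pi.single i ((1 / 2 / (k i : ℝ) : ℝ) : UnitAddCircle)) fun θ => ?_
  simp only [UnitAddTorus.mFourier, ContinuousMap.coe_mk]
  rw [← Finset.mul_prod_erase _ _ (Finset.mem_univ i), ← Finset.mul_prod_erase _ _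
    (Finset.mem_univ i), ← neg_mul]
  congr 1
  · rw [Pi.add_apply, Pi.single_eq_same]
    have := fourier_add_half_inv_index (T := 1) hi one_pos (θ i)
    rw [← this]
  · refine Finset.prod_congr rfl fun j hj => ?_
    rw [Pi.add_apply, Pi.single_eq_of_ne (Finset.ne_of_mem_erase hj), add_zero]

variable {V : Type*} [NormedAddCommGroup V] [InnerProductSpace ℝ V]

/-- The point of the torus with coordinates `⟪ν i, x⟫` modulo `1`. -/
noncomputable def torusPoint (ν : d → V) (x : V) : UnitAddTorus d :=
  fun i => ((⟪ν i, x⟫ : ℝ) : UnitAddCircle)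

theorem continuous_torusPoint {d : Type*} (ν : d → V) : Continuous (torusPoint ν) :=
  continuous_pi fun _ => (AddCircle.continuous_mk' 1).comp (continuous_const.inner continuous_id)

/-- Characters of the torus pull back to plane waves of frequency `∑ i, k i • ν i`, which brings in
the Riemann–Lebesgue lemma. -/
theorem mFourier_torusPoint (k : d → ℤ) (ν : d → V) (x : V) :
    UnitAddTorus.mFourier k (torusPoint ν x) =
      (Real.fourierChar (⟪x, ∑ i, k i • ν i⟫ : ℝ) : ℂ) := by
  simp only [UnitAddTorus.mFourier, ContinuousMap.coe_mk, torusPoint, fourier_coe_apply,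
    Real.fourierChar_apply, ← Complex.exp_sum]
  congr 1
  simp only [inner_sum, ← Int.cast_smul_eq_zsmul ℝ, inner_smul_right, real_inner_comm x]
  push_cast
  rw [Finset.mul_sum, Finset.sum_mul]
  refine Finset.sum_congr rfl fun i _ => ?_
  ring

variable [FiniteDimensional ℝ V] [MeasurableSpace V] [BorelSpace V]

theorem integrable_comp_torusPoint_mul {d : Type*} (G : C(UnitAddTorus d, ℂ)) (ν : d → V) {w : V → ℂ}
    (hw : Integrable w) : Integrable fun x => G (torusPoint ν x) * w x :=
  hw.bdd_mul ((map_continuous G).comp (continuous_torusPoint ν)).aestronglyMeasurable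
    (Eventually.of_forall fun _ => G.norm_coe_le_norm _)

/-- If all nontrivial integer combinations of the frequencies `ν s i` tend to infinity, the points
`torusPoint (ν s) x` become equidistributed with respect to any integrable density. -/
theorem tendsto_integral_comp_torusPoint {μ : Measure (UnitAddTorus d)} [IsProbabilityMeasure μ]
    [μ.IsAddRightInvariant] {ν : ℕ → d → V}
    (hν : ∀ k : d → ℤ, k ≠ 0 → Tendsto (fun s => ‖∑ i, k i • ν s i‖) atTop atTop)
    {w : V → ℂ} (hw : Integrable w) (G : C(UnitAddTorus d, ℂ)) :
    Tendsto (fun s => ∫ x, G (torusPoint (ν s) x) * w x) atTop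
      (𝓝 ((∫ θ, G θ ∂μ) * ∫ x, w x)) := by
  have hmono : ∀ k : d → ℤ, Tendsto (fun s => ∫ x, UnitAddTorus.mFourier k (torusPoint (ν s) x) *
      w x) atTop (𝓝 ((∫ θ, UnitAddTorus.mFourier k θ ∂μ) * ∫ x, w x)) := by
    intro k
    by_cases hk : k = 0
    · subst hk
      simp [UnitAddTorus.mFourier_zero]
    · rw [integral_mFourier_eq_zero hk, zero_mul]
      have h1 : Tendsto (fun s => -∑ i, k i • ν s i) atTop (cocompact V) := by
        rw [← Metric.cobounded_eq_cocompact, ← tendsto_norm_atTop_iff_cobounded]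
        simpa only [norm_neg] using hν k hk
      have h2 := (tendsto_integral_exp_inner_smul_cocompact w).comp h1
      refine h2.congr fun s => ?_
      refine integral_congr_ae (Eventually.of_forall fun x => ?_)
      simp only [mFourier_torusPoint, inner_neg_right, neg_neg, Circle.smul_def, smul_eq_mul]
  have hspan : ∀ H ∈ Submodule.span ℂ (Set.range (UnitAddTorus.mFourier (d := d))),
      Tendsto (fun s => ∫ x, H (torusPoint (ν s) x) * w x) atTop
        (𝓝 ((∫ θ, H θ ∂μ) * ∫ x, w x)) := by
    intro H hH
    induction hH using Submodule.span_induction with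
    | mem H hH => obtain ⟨k, rfl⟩ := hH; exact hmono k
    | zero => simp
    | add H K _ _ ihH ihK =>
      have h := ihH.add ihK
      rw [← add_mul, ← integral_add ((map_continuous H).integrable_of_compactSpace μ)
        ((map_continuous K).integrable_of_compactSpace μ)] at h
      refine h.congr fun s => ?_
      rw [← integral_add (integrable_comp_torusPoint_mul H _ hw)
        (integrable_comp_torusPoint_mul K _ hw)]
      simp only [ContinuousMap.add_apply, add_mul]
    | smul c H _ ih =>
      have h := ih.const_mul c
      rw [← mul_assoc, ← integral_const_mul c (fun θ => H θ)] at h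
      refine h.congr fun s => ?_
      rw [← integral_const_mul]
      simp only [ContinuousMap.smul_apply, smul_eq_mul, mul_assoc]
  set W : ℝ := ∫ x, ‖w x‖ with hW
  have hW0 : 0 ≤ W := integral_nonneg fun x => norm_nonneg _
  rw [Metric.tendsto_atTop]
  intro ε hε
  have hG : G ∈ (Submodule.span ℂ (Set.range (UnitAddTorus.mFourier (d := d)))).topologicalClosure := by
    rw [UnitAddTorus.span_mFourier_closure_eq_top]
    exact Submodule.mem_top
  -- Trigonometric polynomials are uniformly dense. Replacing `G` by `H` costs at most `‖G - H‖ * W`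
  -- on either side of the limit; the `+ 1` covers `W = 0`.
  obtain ⟨H, hH, hGH⟩ := Metric.mem_closure_iff.1 hG (ε / (3 * (W + 1))) (by positivity)
  rw [dist_eq_norm] at hGH
  obtain ⟨S, hS⟩ := Metric.tendsto_atTop.1 (hspan H hH) (ε / 3) (by positivity)
  refine ⟨S, fun s hs => ?_⟩
  have hS := hS s hs
  have hnear : ‖G - H‖ * W < ε / 3 := by
    calc ‖G - H‖ * W ≤ ε / (3 * (W + 1)) * W := by gcongr
      _ < ε / (3 * (W + 1)) * (W + 1) := by gcongr; linarith
      _ = ε / 3 := by field_simp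
  have h1 : dist (∫ x, G (torusPoint (ν s) x) * w x) (∫ x, H (torusPoint (ν s) x) * w x) ≤
      ‖G - H‖ * W := by
    rw [dist_eq_norm, ← integral_sub (integrable_comp_torusPoint_mul G _ hw)
      (integrable_comp_torusPoint_mul H _ hw), hW, ← integral_const_mul]
    refine norm_integral_le_of_norm_le (hw.norm.const_mul _) (Eventually.of_forall fun x => ?_)
    rw [← sub_mul, norm_mul]
    gcongr
    exact (G - H).norm_coe_le_norm _
  have h2 : dist ((∫ θ, H θ ∂μ) * ∫ x, w x) ((∫ θ, G θ ∂μ) * ∫ x, w x) ≤ ‖G - H‖ * W := by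
    rw [dist_eq_norm, ← sub_mul, norm_mul]
    gcongr
    · rw [← integral_sub ((map_continuous H).integrable_of_compactSpace μ)
        ((map_continuous G).integrable_of_compactSpace μ)]
      refine (norm_integral_le_of_norm_le_const (C := ‖G - H‖)
        (Eventually.of_forall fun θ => ?_)).trans_eq (by rw [probReal_univ, mul_one])
      rw [norm_sub_rev]
      exact (G - H).norm_coe_le_norm _
    · exact norm_integral_le_integral_norm _
  have h3 := dist_triangle4 (∫ x, G (torusPoint (ν s) x) * w x)
    (∫ x, H (torusPoint (ν s) x) * w x) ((∫ θ, H θ ∂μ) * ∫ x, w x) ((∫ θ, G θ ∂μ) * ∫ x, w x)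
  linarith

theorem tendsto_integral_comp_torusPoint_real {μ : Measure (UnitAddTorus d)}
    [IsProbabilityMeasure μ] [μ.IsAddRightInvariant] {ν : ℕ → d → V}
    (hν : ∀ k : d → ℤ, k ≠ 0 → Tendsto (fun s => ‖∑ i, k i • ν s i‖) atTop atTop)
    {w : V → ℝ} (hw : Integrable w) {G : UnitAddTorus d → ℝ} (hG : Continuous G) :
    Tendsto (fun s => ∫ x, G (torusPoint (ν s) x) * w x) atTop
      (𝓝 ((∫ θ, G θ ∂μ) * ∫ x, w x)) := by
  have h := tendsto_integral_comp_torusPoint (μ := μ) hν hw.ofReal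
    ⟨fun θ => (G θ : ℂ), Complex.continuous_ofReal.comp hG⟩
  simp only [ContinuousMap.coe_mk, Complex.coe_algebraMap] at h
  rw [integral_complex_ofReal, integral_complex_ofReal, ← Complex.ofReal_mul] at h
  have h' := (Complex.continuous_re.tendsto _).comp h
  rw [Complex.ofReal_re] at h'
  refine h'.congr fun s => ?_
  simp only [Function.comp, ← Complex.ofReal_mul, integral_complex_ofReal, Complex.ofReal_re]

end Equidistribution

/-! ### Frequencies in sectors -/

section Frequencies

open Filter Topology

variable {n : ℕ}

theorem IsSector.isOpen {X : Set (EuclideanSpace ℝ (Fin n))} (hX : IsSector X) : IsOpen X := by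
  obtain ⟨-, r, s, v, -, -, -, rfl⟩ := hX
  simp only [Set.ofPred_and, Set.ofPred_forall]
  refine (isOpen_iInter_of_finite fun j => isOpen_iInter_of_finite fun _ => ?_).inter
    (isOpen_iInter_of_finite fun j => isOpen_iInter_of_finite fun _ => ?_)
  · exact isOpen_lt continuous_const (by fun_prop)
  · exact isOpen_lt (by fun_prop) continuous_const

theorem IsSector.smul_mem {X : Set (EuclideanSpace ℝ (Fin n))} (hX : IsSector X) {t : ℝ}
    (ht : 0 < t) {x : EuclideanSpace ℝ (Fin n)} (hx : x ∈ X) : t • x ∈ X := by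
  obtain ⟨-, r, s, v, -, -, -, rfl⟩ := hX
  refine ⟨fun j hj => ?_, fun j hj => ?_⟩
  · rw [real_inner_smul_left]
    exact mul_pos ht (hx.1 j hj)
  · rw [real_inner_smul_left]
    exact mul_neg_of_pos_of_neg ht (hx.2 j hj)

theorem IsSector.exists_closedBall_subset (hn : 1 ≤ n) {X : Set (EuclideanSpace ℝ (Fin n))}
    (hX : IsSector X) (ρ : ℝ) :
    ∃ x : EuclideanSpace ℝ (Fin n), ρ ≤ ‖x‖ ∧ Metric.closedBall x ρ ⊆ X := by
  have : Nonempty (Fin n) := ⟨⟨0, hn⟩⟩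
  have hne : ({0}ᶜ ∩ X : Set (EuclideanSpace ℝ (Fin n))).Nonempty :=
    (dense_compl_singleton 0).inter_open_nonempty X hX.isOpen hX.1 |>.mono (by
      rw [Set.inter_comm])
  obtain ⟨u, hu0, huX⟩ := hne
  obtain ⟨δ, hδ, hball⟩ := Metric.isOpen_iff.1 hX.isOpen u huX
  have hu : 0 < ‖u‖ := norm_pos_iff.2 hu0
  -- A sector is an open cone, so a ball around `u` is dilated: the second entry makes the centre
  -- long enough, the third shrinks radius `ρ` to at most `δ / 2` after scaling back.
  set t : ℝ := max 1 (max (ρ / ‖u‖) (2 * ρ / δ)) with ht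
  have ht0 : 0 < t := lt_of_lt_of_le one_pos (le_max_left _ _)
  have ht1 : ρ / ‖u‖ ≤ t := (le_max_left _ _).trans (le_max_right _ _)
  have ht2 : 2 * ρ / δ ≤ t := (le_max_right _ _).trans (le_max_right _ _)
  refine ⟨t • u, ?_, fun y hy => ?_⟩
  · rw [norm_smul, Real.norm_of_nonneg ht0.le]
    exact (div_le_iff₀ hu).1 ht1
  · have hy' : t⁻¹ • y ∈ X := by
      refine hball ?_
      rw [Metric.mem_closedBall] at hy
      rw [Metric.mem_ball]
      have e : dist (t⁻¹ • y) u = t⁻¹ * dist y (t • u) := by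
        conv_lhs => rw [← inv_smul_smul₀ ht0.ne' u]
        rw [dist_smul₀, Real.norm_of_nonneg (inv_nonneg.2 ht0.le)]
      rw [e, inv_mul_lt_iff₀ ht0]
      rw [div_le_iff₀ hδ] at ht2
      have := mul_pos ht0 hδ
      rcases le_or_gt ρ 0 with h | h <;> linarith
    have := hX.smul_mem ht0 hy'
    rwa [smul_inv_smul₀ ht0.ne'] at this

/-- Frequencies in given sectors, each with a large ball around it inside the sector and each
much larger than all the previous ones. -/
theorem exists_lacunary_frequencies (hn : 1 ≤ n) {X : ℕ → Set (EuclideanSpace ℝ (Fin n))}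
    (hX : ∀ N, IsSector (X N)) (s : ℝ) :
    ∃ ν : ℕ → EuclideanSpace ℝ (Fin n), ∀ N,
      s * (1 + ∑ M ∈ Finset.range N, ‖ν M‖) ≤ ‖ν N‖ ∧
      Metric.closedBall (ν N) (s * (1 + ∑ M ∈ Finset.range N, ‖ν M‖)) ⊆ X N := by
  choose pick hpick1 hpick2 using fun N => (hX N).exists_closedBall_subset hn
  -- The recursion only needs to carry the running sum of the norms.
  let a : ℕ → ℝ := fun N => Nat.rec 0 (fun N aN => aN + ‖pick N (s * (1 + aN))‖) N
  have ha : ∀ N, ∑ M ∈ Finset.range N, ‖pick M (s * (1 + a M))‖ = a N := fun N => by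
    induction N with
    | zero => rfl
    | succ N ih => rw [Finset.sum_range_succ, ih]
  refine ⟨fun N => pick N (s * (1 + a N)), fun N => ?_⟩
  rw [ha]
  exact ⟨hpick1 _ _, hpick2 _ _⟩

/-- The largest index with nonzero coefficient dominates: with `σ` the sum of the earlier norms and
`D` that of the absolute coefficients, the norm is at least `s * (1 + σ) - D * σ ≥ s` once `s ≥ D`.
-/
theorem tendsto_norm_sum_zsmul {m : ℕ} {ν : ℕ → ℕ → EuclideanSpace ℝ (Fin n)}
    (hν : ∀ s N : ℕ, s * (1 + ∑ M ∈ Finset.range N, ‖ν s M‖) ≤ ‖ν s N‖)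
    {k : DyadicIndex m → ℤ} (hk : k ≠ 0) :
    Tendsto (fun s : ℕ => ‖∑ N : DyadicIndex m, k N • ν s N‖) atTop atTop := by
  classical
  set S : Finset (DyadicIndex m) := Finset.univ.filter fun N => k N ≠ 0 with hS
  have hSne : S.Nonempty := by
    obtain ⟨i, hi⟩ := Function.ne_iff.1 hk
    exact ⟨i, Finset.mem_filter.2 ⟨Finset.mem_univ _, hi⟩⟩
  set N := S.max' hSne with hN
  have hkN : k N ≠ 0 := (Finset.mem_filter.1 (S.max'_mem hSne)).2
  have hkM : ∀ M, N < M → k M = 0 := fun M hM => by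
    by_contra h
    exact (S.le_max' M (Finset.mem_filter.2 ⟨Finset.mem_univ _, h⟩)).not_gt hM
  set D : ℝ := ∑ M, |(k M : ℝ)| with hD
  have hD0 : ∀ M, |(k M : ℝ)| ≤ D := fun M =>
    Finset.single_le_sum (f := fun M => |(k M : ℝ)|) (fun _ _ => abs_nonneg _) (Finset.mem_univ M)
  refine tendsto_atTop_mono' _ ?_ tendsto_natCast_atTop_atTop
  filter_upwards [eventually_ge_atTop ⌈D⌉₊] with s hs
  have hs : D ≤ s := (Nat.le_ceil D).trans (by exact_mod_cast hs)
  set σ : ℝ := ∑ M ∈ Finset.range N, ‖ν s M‖ with hσ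
  have hσ0 : 0 ≤ σ := Finset.sum_nonneg fun _ _ => norm_nonneg _
  have hrest : ‖∑ M ∈ Finset.univ.erase N, k M • ν s M‖ ≤ D * σ := by
    have hle : ∀ M ∈ Finset.univ.erase N, ‖k M • ν s (M : ℕ)‖ ≤
        D * if (M : ℕ) < N then ‖ν s M‖ else 0 := fun M hM => by
      rw [← Int.cast_smul_eq_zsmul ℝ, norm_smul, Real.norm_eq_abs]
      split_ifs with h
      · gcongr
        exact hD0 M
      · have : N < M := lt_of_le_of_ne (not_lt.1 h) (Finset.ne_of_mem_erase hM).symm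
        rw [hkM M this]
        simp
    refine (norm_sum_le_of_le _ hle).trans ?_
    rw [← Finset.mul_sum]
    have hD' : 0 ≤ D := Finset.sum_nonneg fun _ _ => abs_nonneg _
    gcongr
    refine (Finset.sum_le_univ_sum_of_nonneg fun M => ?_).trans ?_
    · split_ifs
      exacts [norm_nonneg _, le_rfl]
    · rw [← sum_Ico_eq_sum_dyadicIndex m fun M => if M < (N : ℕ) then ‖ν s M‖ else 0,
        ← Finset.sum_filter]
      refine Finset.sum_le_sum_of_subset_of_nonneg (fun M hM => ?_) fun _ _ _ => norm_nonneg _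
      exact Finset.mem_range.2 (Finset.mem_filter.1 hM).2
  have hlead : ‖ν s N‖ ≤ ‖k N • ν s (N : ℕ)‖ := by
    rw [← Int.cast_smul_eq_zsmul ℝ, norm_smul, Real.norm_eq_abs]
    have : (1 : ℝ) ≤ |(k N : ℝ)| := by exact_mod_cast Int.one_le_abs hkN
    exact le_mul_of_one_le_left (norm_nonneg _) this
  rw [← Finset.add_sum_erase _ _ (Finset.mem_univ N)]
  have h1 := norm_sub_le_norm_add (k N • ν s (N : ℕ)) (∑ M ∈ Finset.univ.erase N, k M • ν s M)
  have h2 := hν s N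
  rw [← hσ] at h2
  nlinarith [mul_le_mul_of_nonneg_right hs hσ0]

end Frequencies

/-! ### Trigonometric polynomials -/

section BandLimited

variable {V : Type*} [NormedAddCommGroup V] [InnerProductSpace ℝ V]

/-- The character `x ↦ exp (2 π i ⟪x, ξ⟫)`. -/
noncomputable def planeWave (ξ x : V) : ℂ := (Real.fourierChar (⟪x, ξ⟫ : ℝ) : ℂ)

theorem planeWave_add (ξ η x : V) : planeWave (ξ + η) x = planeWave ξ x * planeWave η x := by
  rw [planeWave, inner_add_right, AddChar.map_add_eq_mul, Circle.coe_mul]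
  rfl

theorem planeWave_zero (x : V) : planeWave 0 x = 1 := by
  rw [planeWave, inner_zero_right, AddChar.map_zero_eq_one, Circle.coe_one]

theorem planeWave_neg (ξ x : V) : planeWave (-ξ) x = starRingEnd ℂ (planeWave ξ x) := by
  rw [planeWave, inner_neg_right, AddChar.map_neg_eq_inv, Circle.coe_inv_eq_conj]
  rfl

theorem norm_planeWave (ξ x : V) : ‖planeWave ξ x‖ = 1 := Circle.norm_coe _

theorem contDiff_planeWave (ξ : V) : ContDiff ℝ ∞ (planeWave ξ) := by
  have : planeWave ξ = fun x => Complex.exp (2 * Real.pi * (⟪x, ξ⟫ : ℝ) * Complex.I) := by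
    ext x
    rw [planeWave, Real.fourierChar_apply]
    push_cast
    rfl
  rw [this]
  have h : ContDiff ℝ ∞ fun x : V => ((⟪x, ξ⟫ : ℝ) : ℂ) :=
    Complex.ofRealCLM.contDiff.comp (contDiff_id.inner ℝ contDiff_const)
  fun_prop

/-- Trigonometric polynomials with frequencies of norm at most `R`. -/
noncomputable def trigPoly (V : Type*) [NormedAddCommGroup V] [InnerProductSpace ℝ V] (R : ℝ) :
    Submodule ℂ (V → ℂ) :=
  Submodule.span ℂ (planeWave '' Metric.closedBall 0 R)

theorem planeWave_mem_trigPoly {ξ : V} {R : ℝ} (h : ‖ξ‖ ≤ R) : planeWave ξ ∈ trigPoly V R :=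
  Submodule.subset_span ⟨ξ, by simpa using h, rfl⟩

theorem trigPoly_mono {R S : ℝ} (h : R ≤ S) : trigPoly V R ≤ trigPoly V S :=
  Submodule.span_mono (Set.image_mono (Metric.closedBall_subset_closedBall h))

theorem mul_mem_trigPoly {R S : ℝ} {f g : V → ℂ} (hf : f ∈ trigPoly V R) (hg : g ∈ trigPoly V S) :
    f * g ∈ trigPoly V (R + S) := by
  have h := Submodule.mul_mem_mul hf hg
  rw [trigPoly, trigPoly, Submodule.span_mul_span] at h
  refine Submodule.span_mono ?_ h
  rintro _ ⟨_, ⟨ξ, hξ, rfl⟩, _, ⟨η, hη, rfl⟩, rfl⟩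
  refine ⟨ξ + η, ?_, funext fun x => planeWave_add ξ η x⟩
  rw [mem_closedBall_zero_iff] at *
  exact (norm_add_le _ _).trans (add_le_add hξ hη)

theorem const_mem_trigPoly {R : ℝ} (hR : 0 ≤ R) (c : ℂ) : (fun _ : V => c) ∈ trigPoly V R := by
  have h := (trigPoly V R).smul_mem c (planeWave_mem_trigPoly (ξ := 0) (by simpa using hR))
  convert h using 1
  ext x
  simp [planeWave_zero]

theorem pow_mem_trigPoly {R : ℝ} {f : V → ℂ} (hf : f ∈ trigPoly V R) (i : ℕ) :
    f ^ i ∈ trigPoly V (i * R) := by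
  induction i with
  | zero =>
    rw [pow_zero, Nat.cast_zero, zero_mul]
    exact const_mem_trigPoly le_rfl 1
  | succ i ih =>
    rw [pow_succ]
    convert mul_mem_trigPoly ih hf using 2
    push_cast
    ring

theorem eval_mem_trigPoly {R : ℝ} (hR : 0 ≤ R) (q : Polynomial ℝ) {c : V → ℝ}
    (hc : (fun x => (c x : ℂ)) ∈ trigPoly V R) :
    (fun x => ((q.eval (c x) : ℝ) : ℂ)) ∈ trigPoly V (q.natDegree * R) := by
  have h : (fun x => ((q.eval (c x) : ℝ) : ℂ)) =
      ∑ i ∈ Finset.range (q.natDegree + 1), (q.coeff i : ℂ) • (fun x => (c x : ℂ)) ^ i := by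
    ext x
    rw [Polynomial.eval_eq_sum_range]
    simp [Finset.sum_apply]
  rw [h]
  refine Submodule.sum_mem _ fun i hi => Submodule.smul_mem _ _ ?_
  refine trigPoly_mono ?_ (pow_mem_trigPoly hc i)
  have : i ≤ q.natDegree := Nat.lt_succ_iff.1 (Finset.mem_range.1 hi)
  gcongr

theorem re_planeWave_mem_trigPoly (ξ : V) :
    (fun x => ((planeWave ξ x).re : ℂ)) ∈ trigPoly V ‖ξ‖ := by
  have h : (fun x => ((planeWave ξ x).re : ℂ)) =
      (1 / 2 : ℂ) • (planeWave ξ + planeWave (-ξ)) := by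
    ext x
    rw [Pi.smul_apply, Pi.add_apply, planeWave_neg, Complex.add_conj, smul_eq_mul]
    push_cast
    ring
  rw [h]
  exact Submodule.smul_mem _ _ (Submodule.add_mem _ (planeWave_mem_trigPoly le_rfl)
    (planeWave_mem_trigPoly (norm_neg ξ).le))

theorem torusCoord_torusPoint {m : ℕ} (ν : ℕ → V) (x : V) {N : ℕ} (hN : N ∈ Set.Ico 1 (2 ^ m)) :
    torusCoord (torusPoint (fun M : DyadicIndex m => ν M) x) N = planeWave (ν N) x := by
  rw [torusCoord, dif_pos hN, torusPoint, AddCircle.toCircle_apply_mk, planeWave,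
    Real.fourierChar_apply, Circle.coe_exp, real_inner_comm, div_one]

/-- Each ancestor `M` contributes one factor of degree at most `q.natDegree` in the waves of
frequency `± ν M`. Ancestors are distinct and smaller than `N`, so their radii fit into the full
sum. -/
theorem torusWeight_torusPoint_mem_trigPoly {m : ℕ} (q : Polynomial ℝ) (ν : ℕ → V) {N : ℕ}
    (hN : N < 2 ^ m) :
    (fun x => (torusWeight q (torusPoint (fun M : DyadicIndex m => ν M) x) N : ℂ)) ∈
      trigPoly V (q.natDegree * ∑ M ∈ Finset.range N, ‖ν M‖) := by
  induction N using Nat.strong_induction_on with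
  | _ N ih =>
    by_cases hN1 : N ≤ 1
    · simp only [torusWeight, treeWeight_of_le_one _ hN1]
      exact const_mem_trigPoly (by positivity) _
    · have hmem : N / 2 ∈ Set.Ico 1 (2 ^ m) := ⟨by omega, by omega⟩
      have h1 := ih (N / 2) (by omega) (by omega)
      have h2 : (fun x => ((q.eval
          (torusCoord (torusPoint (fun M : DyadicIndex m => ν M) x) (N / 2)).re : ℝ) : ℂ)) ∈
          trigPoly V (q.natDegree * ‖ν (N / 2)‖) := by
        simp only [torusCoord_torusPoint ν _ hmem]
        exact eval_mem_trigPoly (norm_nonneg _) q (re_planeWave_mem_trigPoly _)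
      have h3 : (fun x => (((if N % 2 = 1 then
          q.eval (torusCoord (torusPoint (fun M : DyadicIndex m => ν M) x) (N / 2)).re
          else 1 - q.eval (torusCoord (torusPoint (fun M : DyadicIndex m => ν M) x) (N / 2)).re
          : ℝ)) : ℂ)) ∈ trigPoly V (q.natDegree * ‖ν (N / 2)‖) := by
        split_ifs
        · exact h2
        · have h := Submodule.sub_mem _ (const_mem_trigPoly (V := V)
            (R := q.natDegree * ‖ν (N / 2)‖) (by positivity) 1) h2
          convert h using 1
          ext x
          simp
      have h4 := mul_mem_trigPoly h1 h3
      simp only [torusWeight, treeWeight_of_one_lt _ (not_le.1 hN1)] at h4 ⊢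
      refine trigPoly_mono ?_ (by
        convert h4 using 1
        ext x
        rw [Pi.mul_apply, Complex.ofReal_mul])
      rw [← mul_add, ← Finset.sum_range_succ fun M => ‖ν M‖]
      gcongr
      omega

/-! ### Fourier supports and the band-limited envelope -/

variable [FiniteDimensional ℝ V] [MeasurableSpace V] [BorelSpace V]

theorem fourier_planeWave_mul (ξ : V) (φ : V → ℂ) (η : V) :
    𝓕 (fun x => planeWave ξ x * φ x) η = 𝓕 φ (η - ξ) := by
  rw [Real.fourier_eq, Real.fourier_eq]
  refine integral_congr_ae (Filter.Eventually.of_forall fun x => ?_)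
  simp only [Circle.smul_def, smul_eq_mul]
  rw [← mul_assoc]
  congr 1
  rw [planeWave, ← Circle.coe_mul, ← AddChar.map_add_eq_mul, inner_sub_right]
  congr 2
  ring

/-- Multiplying a smooth integrable function by a trigonometric polynomial and a plane wave
translates and enlarges the support of the Fourier transform. -/
theorem mul_trigPoly_spec {φ : V → ℂ} (hφ : ContDiff ℝ ∞ φ) (hφi : Integrable φ) {R₀ R : ℝ}
    (hsupp : tsupport (𝓕 φ) ⊆ Metric.closedBall 0 R₀) (ξ : V) {g : V → ℂ}
    (hg : g ∈ trigPoly V R) :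
    ContDiff ℝ ∞ (fun x => planeWave ξ x * g x * φ x) ∧
      Integrable (fun x => planeWave ξ x * g x * φ x) ∧
      tsupport (𝓕 (fun x => planeWave ξ x * g x * φ x)) ⊆ Metric.closedBall ξ (R + R₀) := by
  -- Vanishing off a closed ball, unlike the support inclusion, is visibly linear in `g` and suits
  -- induction over the span.
  suffices h : ContDiff ℝ ∞ (fun x => planeWave ξ x * g x * φ x) ∧
      Integrable (fun x => planeWave ξ x * g x * φ x) ∧
      ∀ η ∉ Metric.closedBall ξ (R + R₀), 𝓕 (fun x => planeWave ξ x * g x * φ x) η = 0 by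
    refine ⟨h.1, h.2.1, closure_minimal (fun η hη => ?_) Metric.isClosed_closedBall⟩
    by_contra h'
    exact hη (h.2.2 η h')
  induction hg using Submodule.span_induction with
  | mem g hg =>
    obtain ⟨ζ, hζ, rfl⟩ := hg
    have hint : Integrable (fun x => planeWave ξ x * planeWave ζ x * φ x) := by
      refine hφi.bdd_mul (c := 1) ?_ (Filter.Eventually.of_forall fun x => ?_)
      · exact ((contDiff_planeWave ξ).continuous.mul
          (contDiff_planeWave ζ).continuous).aestronglyMeasurable
      · rw [norm_mul, norm_planeWave, norm_planeWave, one_mul]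
    refine ⟨((contDiff_planeWave ξ).mul (contDiff_planeWave ζ)).mul hφ, hint, fun η hη => ?_⟩
    simp only [← planeWave_add]
    rw [fourier_planeWave_mul]
    refine image_eq_zero_of_notMem_tsupport fun h => hη ?_
    have h1 := mem_closedBall_zero_iff.1 (hsupp h)
    rw [mem_closedBall_zero_iff] at hζ
    rw [mem_closedBall_iff_norm]
    calc ‖η - ξ‖ = ‖ζ + (η - (ξ + ζ))‖ := by congr 1; abel
      _ ≤ R + R₀ := (norm_add_le _ _).trans (add_le_add hζ h1)
  | zero =>
    simp only [Pi.zero_apply, mul_zero, zero_mul]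
    refine ⟨contDiff_const, integrable_zero _ _ _, fun η _ => ?_⟩
    rw [Real.fourier_eq]
    simp
  | add g h _ _ ihg ihh =>
    have e : (fun x => planeWave ξ x * (g + h) x * φ x) =
        fun x => planeWave ξ x * g x * φ x + planeWave ξ x * h x * φ x := by
      ext x
      rw [Pi.add_apply, mul_add, add_mul]
    rw [e]
    refine ⟨ihg.1.add ihh.1, ihg.2.1.add ihh.2.1, fun η hη => ?_⟩
    have hadd : 𝓕 (fun x => planeWave ξ x * g x * φ x + planeWave ξ x * h x * φ x) η =
        𝓕 (fun x => planeWave ξ x * g x * φ x) η + 𝓕 (fun x => planeWave ξ x * h x * φ x) η := by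
      have hi : ∀ f : V → ℂ, Integrable f →
          Integrable fun x => Real.fourierChar (-⟪x, η⟫) • f x := fun f hf =>
        (Real.fourierIntegral_convergent_iff η).2 hf
      rw [Real.fourier_eq, Real.fourier_eq, Real.fourier_eq,
        ← integral_add (hi _ ihg.2.1) (hi _ ihh.2.1)]
      simp only [smul_add]
    rw [hadd, ihg.2.2 η hη, ihh.2.2 η hη, add_zero]
  | smul c g _ ihg =>
    have e : (fun x => planeWave ξ x * (c • g) x * φ x) =
        fun x => c * (planeWave ξ x * g x * φ x) := by
      ext x
      rw [Pi.smul_apply, smul_eq_mul]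
      ring
    rw [e]
    refine ⟨contDiff_const.mul ihg.1, ihg.2.1.const_mul c, fun η hη => ?_⟩
    have hs : 𝓕 (fun x => c * (planeWave ξ x * g x * φ x)) η =
        c * 𝓕 (fun x => planeWave ξ x * g x * φ x) η := by
      rw [Real.fourier_eq, Real.fourier_eq, ← integral_const_mul]
      simp only [Circle.smul_def, smul_eq_mul, mul_left_comm c]
    rw [hs, ihg.2.2 η hη, mul_zero]

/-- A smooth integrable function with Fourier transform supported in the unit ball, bounded by `1`
and equal to `1` at the origin. -/
theorem exists_bandLimited_envelope (V : Type*) [NormedAddCommGroup V] [InnerProductSpace ℝ V]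
    [FiniteDimensional ℝ V] [MeasurableSpace V] [BorelSpace V] :
    ∃ φ : V → ℂ, ContDiff ℝ ∞ φ ∧ Integrable φ ∧ tsupport (𝓕 φ) ⊆ Metric.closedBall 0 1 ∧
      (∀ x, ‖φ x‖ ≤ 1) ∧ φ 0 = 1 := by
  let b : ContDiffBump (0 : V) := ⟨1 / 2, 1, by norm_num, by norm_num⟩
  have hbc : HasCompactSupport fun x => ((b x : ℝ) : ℂ) :=
    b.hasCompactSupport.comp_left (g := fun y : ℝ => (y : ℂ)) Complex.ofReal_zero
  have hbs : ContDiff ℝ ∞ fun x => ((b x : ℝ) : ℂ) :=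
    Complex.ofRealCLM.contDiff.comp b.contDiff
  let B : SchwartzMap V ℂ := hbc.toSchwartzMap hbs
  have hB : ∀ x, B x = (b x : ℝ) := fun x => rfl
  set I : ℝ := ∫ x, b x with hI
  have hI0 : 0 < I := b.integral_pos
  -- The inverse transform of a nonnegative bump of mass `I` is largest at the origin, with value
  -- `I`.
  let Φ : SchwartzMap V ℂ := (I : ℂ)⁻¹ • 𝓕⁻ B
  have hΦ : 𝓕 Φ = (I : ℂ)⁻¹ • B := by
    simp only [Φ, FourierTransform.fourier_smul, FourierTransform.fourier_fourierInv_eq]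
  have hval : ∀ x, Φ x = (I : ℂ)⁻¹ * 𝓕⁻ (B : V → ℂ) x := fun x => by
    rw [← SchwartzMap.fourierInv_coe]; rfl
  refine ⟨Φ, Φ.smooth ⊤, Φ.integrable, ?_, fun x => ?_, ?_⟩
  · rw [← SchwartzMap.fourier_coe, hΦ]
    refine closure_minimal (fun x hx => ?_) Metric.isClosed_closedBall
    have hx' : b x ≠ 0 := fun h => hx (by simp [hB, h])
    have : x ∈ Function.support b := hx'
    rw [b.support_eq] at this
    exact Metric.ball_subset_closedBall this
  · rw [hval, norm_mul, norm_inv, Complex.norm_real, Real.norm_of_nonneg hI0.le,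
      inv_mul_le_iff₀ hI0, mul_one, Real.fourierInv_eq]
    refine (norm_integral_le_integral_norm _).trans_eq ?_
    rw [hI]
    refine integral_congr_ae (Filter.Eventually.of_forall fun v => ?_)
    simp only [Circle.norm_smul, hB, Complex.norm_real, Real.norm_of_nonneg b.nonneg]
  · rw [hval, Real.fourierInv_eq]
    simp only [inner_zero_right, AddChar.map_zero_eq_one, one_smul, hB]
    rw [integral_complex_ofReal, ← hI, inv_mul_cancel₀]
    exact_mod_cast hI0.ne'

end BandLimited

/-! ### The functions on `ℝⁿ` -/

/-- An `L^q` bound with respect to the density `‖φ‖ ≤ 1` bounds the `L^p` norm of `F φ` for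
`1 ≤ p ≤ q`. -/
theorem eLpNorm_mul_le_of_integral_le {X : Type*} [MeasurableSpace X] {μ : Measure X}
    {φ F : X → ℂ} (hφm : Measurable φ) (hFm : Measurable F) (hφ : Integrable φ μ)
    (hφ1 : ∀ x, ‖φ x‖ ≤ 1) {A B : ℝ} (hA1 : 1 ≤ A) (hA : ∫ x, ‖φ x‖ ∂μ ≤ A) (hB0 : 0 ≤ B) {k : ℕ}
    (hFi : Integrable (fun x => ‖F x‖ ^ k * ‖φ x‖) μ)
    (hB : ∫ x, ‖F x‖ ^ k * ‖φ x‖ ∂μ ≤ B) {p : ℝ} (hp1 : 1 ≤ p) (hpk : p ≤ k) :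
    eLpNorm (fun x => F x * φ x) (ENNReal.ofReal p) μ ≤
      ENNReal.ofReal (A * B ^ (1 / (k : ℝ))) := by
  have hp0 : 0 < p := by linarith
  have hk0 : (0 : ℝ) < k := by linarith
  have hk0' : k ≠ 0 := by rintro rfl; simp at hk0
  set ν : Measure X := μ.withDensity fun x => ‖φ x‖ₑ with hν
  have hνm : Measurable fun x => ‖φ x‖ₑ := hφm.enorm
  have hlint : ∀ r : ℝ, ∫⁻ x, ‖F x‖ₑ ^ r ∂ν = ∫⁻ x, ‖φ x‖ₑ * ‖F x‖ₑ ^ r ∂μ := fun r => by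
    rw [hν, lintegral_withDensity_eq_lintegral_mul _ hνm (hFm.enorm.pow_const r)]
    rfl
  have hpt : (ENNReal.ofReal p).toReal = p := ENNReal.toReal_ofReal hp0.le
  -- Since `‖φ‖ ≤ 1 ≤ p`, one has `‖φ‖ ^ p ≤ ‖φ‖`, so the envelope may be absorbed into the finite
  -- measure `ν`, where `L^p` norms are comparable by Hölder.
  have h1 : eLpNorm (fun x => F x * φ x) (ENNReal.ofReal p) μ ≤ eLpNorm F (ENNReal.ofReal p) ν := by
    rw [eLpNorm_eq_lintegral_rpow_enorm_toReal (by simpa using hp0) ENNReal.ofReal_ne_top,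
      eLpNorm_eq_lintegral_rpow_enorm_toReal (by simpa using hp0) ENNReal.ofReal_ne_top, hpt,
      hlint]
    gcongr with x
    rw [enorm_mul, ENNReal.mul_rpow_of_nonneg _ _ hp0.le, mul_comm]
    gcongr
    have hle : ‖φ x‖ₑ ≤ 1 := by
      rw [← ofReal_norm, ENNReal.ofReal_le_one]
      exact hφ1 x
    exact (ENNReal.rpow_le_rpow_of_exponent_ge hle hp1).trans_eq (ENNReal.rpow_one _)
  have huniv : ν Set.univ ≤ ENNReal.ofReal A := by
    rw [hν, withDensity_apply _ MeasurableSet.univ, Measure.restrict_univ,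
      ← ofReal_integral_norm_eq_lintegral_enorm hφ]
    exact ENNReal.ofReal_le_ofReal hA
  have h2 := eLpNorm_le_eLpNorm_mul_rpow_measure_univ (μ := ν) (f := F)
    (p := ENNReal.ofReal p) (q := (k : ENNReal))
    (by rw [← ENNReal.ofReal_natCast]; exact ENNReal.ofReal_le_ofReal hpk)
    hFm.aestronglyMeasurable
  have h3 : eLpNorm F (k : ENNReal) ν ≤ ENNReal.ofReal (B ^ (1 / (k : ℝ))) := by
    rw [eLpNorm_eq_lintegral_rpow_enorm_toReal (by simpa using hk0') (ENNReal.natCast_ne_top k),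
      ENNReal.toReal_natCast, hlint, ← ENNReal.ofReal_rpow_of_nonneg hB0 (by positivity)]
    gcongr
    have e : ∀ x, ‖φ x‖ₑ * ‖F x‖ₑ ^ (k : ℝ) = ‖‖F x‖ ^ k * ‖φ x‖‖ₑ := fun x => by
      rw [ENNReal.rpow_natCast, enorm_mul, enorm_pow, enorm_norm, enorm_norm, mul_comm]
    simp only [e]
    rw [← ofReal_integral_norm_eq_lintegral_enorm hFi]
    refine ENNReal.ofReal_le_ofReal (le_trans (le_of_eq ?_) hB)
    refine integral_congr_ae (Filter.Eventually.of_forall fun x => ?_)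
    exact Real.norm_of_nonneg (by positivity)
  -- The exponent lies in `[0, 1]` and `A ≥ 1`, so this bound is uniform in `p`.
  have h4 : ν Set.univ ^ (1 / (ENNReal.ofReal p).toReal - 1 / (k : ENNReal).toReal) ≤
      ENNReal.ofReal A := by
    rw [hpt, ENNReal.toReal_natCast]
    have he0 : 0 ≤ 1 / p - 1 / (k : ℝ) := sub_nonneg.2 (one_div_le_one_div_of_le hp0 hpk)
    have he1 : 1 / p - 1 / (k : ℝ) ≤ 1 := by
      have : 1 / p ≤ 1 := (div_le_one hp0).2 hp1
      have : 0 ≤ 1 / (k : ℝ) := by positivity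
      linarith
    refine (ENNReal.rpow_le_rpow huniv he0).trans ?_
    refine (ENNReal.rpow_le_rpow_of_exponent_le ?_ he1).trans_eq (ENNReal.rpow_one _)
    rw [← ENNReal.ofReal_one]
    exact ENNReal.ofReal_le_ofReal hA1
  refine h1.trans (h2.trans ?_)
  rw [mul_comm A, ENNReal.ofReal_mul (by positivity)]
  gcongr

theorem measurableSet_unitCube (n : ℕ) : MeasurableSet (unitCube n) := by
  have : unitCube n = ⋂ i, {x | x i ∈ Set.Icc (0 : ℝ) 1} := by
    ext x; simp [unitCube]
  rw [this]
  refine MeasurableSet.iInter fun i => ?_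
  have hc : Continuous fun x : EuclideanSpace ℝ (Fin n) => x i := by fun_prop
  exact (isClosed_Icc.preimage hc).measurableSet

theorem volume_unitCube_lt_top (n : ℕ) : volume (unitCube n) < ⊤ := by
  have : unitCube n ⊆ Metric.closedBall 0 (√n) := fun x hx => by
    rw [mem_closedBall_zero_iff, EuclideanSpace.norm_eq]
    refine Real.sqrt_le_sqrt ?_
    calc ∑ i, ‖x i‖ ^ 2 ≤ ∑ _i : Fin n, (1 : ℝ) := Finset.sum_le_sum fun i _ => by
          rw [Real.norm_of_nonneg (hx i).1]
          exact pow_le_one₀ (hx i).1 (hx i).2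
      _ = n := by simp
  exact (measure_mono this).trans_lt measure_closedBall_lt_top

/-- The origin is a corner of the cube: points slightly along the main diagonal lie in both `U` and
the open cube. -/
theorem volume_unitCube_inter_pos {n : ℕ} {U : Set (EuclideanSpace ℝ (Fin n))} (hU : IsOpen U)
    (h0 : (0 : EuclideanSpace ℝ (Fin n)) ∈ U) : 0 < volume (unitCube n ∩ U) := by
  set W : Set (EuclideanSpace ℝ (Fin n)) := (⋂ i, {x | x i ∈ Set.Ioo (0 : ℝ) 1}) ∩ U with hW
  have hWo : IsOpen W := by
    refine (isOpen_iInter_of_finite fun i => ?_).inter hU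
    have hc : Continuous fun x : EuclideanSpace ℝ (Fin n) => x i := by fun_prop
    exact isOpen_Ioo.preimage hc
  have hWne : W.Nonempty := by
    set u : EuclideanSpace ℝ (Fin n) := WithLp.toLp 2 fun _ => 1 with hu
    have ht : Filter.Tendsto (fun t : ℝ => t • u) (nhdsWithin 0 (Set.Ioi 0)) (nhds 0) := by
      have : Continuous fun t : ℝ => t • u := by fun_prop
      have h := this.tendsto 0
      rw [zero_smul] at h
      exact h.mono_left nhdsWithin_le_nhds
    obtain ⟨t, htU, ht01⟩ := ((ht.eventually (hU.mem_nhds h0)).and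
      (Ioo_mem_nhdsGT (zero_lt_one' ℝ))).exists
    refine ⟨t • u, Set.mem_iInter.2 fun i => ?_, htU⟩
    simpa [hu] using ht01
  refine (hWo.measure_pos volume hWne).trans_le (measure_mono fun x hx => ⟨fun i => ?_, hx.2⟩)
  exact Set.Ioo_subset_Icc_self (Set.mem_iInter.1 hx.1 i)

theorem proposition3p2 (n : ℕ) (hn : 1 ≤ n) (p₀ : ℕ) (hp₀ : 1 ≤ p₀) :
    ∃ C₁ C₂ C₃ : ℝ, 0 < C₁ ∧ 0 < C₂ ∧ 0 < C₃ ∧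
      ∀ m : ℕ, 1 ≤ m →
      ∀ X : DyadicIndex m → Set (EuclideanSpace ℝ (Fin n)),
        (∀ N, IsSector (X N)) → (∀ N M, N ≠ M → Disjoint (X N) (X M)) →
        ∃ f : DyadicIndex m → EuclideanSpace ℝ (Fin n) → ℂ,
          (∀ N, ContDiff ℝ ∞ (f N) ∧ Integrable (f N) volume ∧ HasCompactSupport (𝓕 (f N))) ∧
          (∀ N, tsupport (𝓕 (f N)) ⊆ X N) ∧
          (∀ p : ℝ, 1 ≤ p → p ≤ 2 * p₀ →
            eLpNorm (fun x => ∑ N, f N x) (ENNReal.ofReal p) volume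
              ≤ ENNReal.ofReal (C₁ * √m)) ∧
          ENNReal.ofReal C₃ <
            volume {x ∈ unitCube n |
              C₂ * m ≤ ⨆ l : DyadicIndex m,
                ‖∑ N ∈ Finset.univ.filter (fun N => N ≤ l), f (dyadicPerm m N) x‖} := by
  obtain ⟨φ, hφs, hφi, hφsupp, hφ1, hφ0⟩ :=
    exists_bandLimited_envelope (EuclideanSpace ℝ (Fin n))
  have hφc : Continuous φ := hφs.continuous
  set A : ℝ := ∫ x, ‖φ x‖ with hA
  have hA0 : 0 ≤ A := integral_nonneg fun x => norm_nonneg _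
  set K : ℝ := 2 ^ (2 * p₀) * (2 * p₀).factorial * (4 * Real.exp (1 / 2)) with hK
  have hK0 : 0 ≤ K := by positivity
  set Q : Set (EuclideanSpace ℝ (Fin n)) := unitCube n ∩ {x | 1 / 2 < ‖φ x‖} with hQ
  have hQm : MeasurableSet Q :=
    (measurableSet_unitCube n).inter (isOpen_lt continuous_const hφc.norm).measurableSet
  have hQfin : volume Q ≠ ⊤ :=
    ((measure_mono Set.inter_subset_left).trans_lt (volume_unitCube_lt_top n)).ne
  have hQpos : 0 < volume.real Q := by
    refine ENNReal.toReal_pos (volume_unitCube_inter_pos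
      (isOpen_lt continuous_const hφc.norm) ?_).ne' hQfin
    simp only [Set.mem_ofPred_eq, hφ0]
    norm_num
  -- All constants come from `φ` and `p₀` alone. The `+ 1` in `A * K + 1` and the gap between `1 /
  -- 16` and `3 / 32` leave room for passing from the limit to a finite `s`; `1 / 32` is `1 / 16`
  -- times the lower bound `1 / 2` for the envelope on `Q`.
  refine ⟨(A + 1) * (A * K + 1) ^ (1 / ((2 * p₀ : ℕ) : ℝ)), 1 / 32, volume.real Q / 16,
    by positivity, by norm_num, by positivity, fun m hm X hX _ => ?_⟩
  have hm0 : (0 : ℝ) < m := by exact_mod_cast hm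
  have h1m : 1 ∈ Set.Ico 1 (2 ^ m) := ⟨le_rfl, Nat.one_lt_two_pow (by omega)⟩
  obtain ⟨q, hq, hqE⟩ := exists_polynomial_le_integral_torusMax hm
  set Y : ℕ → Set (EuclideanSpace ℝ (Fin n)) :=
    fun N => if h : N ∈ Set.Ico 1 (2 ^ m) then X ⟨N, h⟩ else X ⟨1, h1m⟩ with hYdef
  have hY : ∀ N, IsSector (Y N) := fun N => by
    rw [hYdef]
    dsimp only
    split_ifs
    exacts [hX _, hX _]
  choose ν hν using fun s : ℕ => exists_lacunary_frequencies hn hY s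
  have hcomb := fun (k : DyadicIndex m → ℤ) (hk : k ≠ 0) =>
    tendsto_norm_sum_zsmul (ν := ν) (fun s N => (hν s N).1) hk
  set F : UnitAddTorus (DyadicIndex m) → ℂ := fun θ =>
    ∑ N ∈ Finset.Ico 1 (2 ^ m), (torusWeight q θ N : ℂ) * torusCoord θ N with hF
  have hFc : Continuous F := continuous_finsetSum _ fun N _ =>
    (Complex.continuous_ofReal.comp (continuous_torusWeight q N)).mul (continuous_torusCoord N)
  have hFE : ∫ θ, ‖F θ‖ ^ (2 * p₀) ∂torusHaar (DyadicIndex m) ≤ K * m ^ p₀ :=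
    integral_norm_sum_pow_le hm hq p₀
  have hMc := continuous_torusMax hm q
  have hlim1 := tendsto_integral_comp_torusPoint_real (μ := torusHaar (DyadicIndex m)) hcomb
    hφi.norm (G := fun θ => ‖F θ‖ ^ (2 * p₀)) (by fun_prop)
  have hQi : Integrable (Q.indicator (1 : EuclideanSpace ℝ (Fin n) → ℝ)) :=
    (integrable_indicator_iff hQm).2 (integrableOn_const hQfin)
  have hlim2 := tendsto_integral_comp_torusPoint_real (μ := torusHaar (DyadicIndex m)) hcomb
    hQi (G := fun θ => max 0 (min 1 (16 / m * torusMax q θ - 1))) (by fun_prop)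
  rw [integral_indicator_one hQm] at hlim2
  have hlt1 : (∫ θ, ‖F θ‖ ^ (2 * p₀) ∂torusHaar (DyadicIndex m)) * ∫ x, ‖φ x‖ <
      (A * K + 1) * m ^ p₀ := by
    have : (0 : ℝ) < m ^ p₀ := by positivity
    rw [← hA]
    nlinarith [mul_le_mul_of_nonneg_right hFE hA0]
  have hlt2 : volume.real Q / 16 < (∫ θ, max 0 (min 1 (16 / m * torusMax q θ - 1))
      ∂torusHaar (DyadicIndex m)) * volume.real Q := by
    nlinarith [mul_le_mul_of_nonneg_right hqE hQpos.le]
  -- One large `s` serves all purposes: moment bound, lower bound on `Q`, and `s ≥ max 1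
  -- q.natDegree`, which places the spectrum of the `N`-th function inside the ball around `ν s N`
  -- contained in the sector.
  obtain ⟨s, ⟨hs1, hs2⟩, hs3⟩ := (((hlim1.eventually (gt_mem_nhds hlt1)).and
    (hlim2.eventually (lt_mem_nhds hlt2))).and
    (Filter.eventually_ge_atTop (max 1 q.natDegree))).exists
  set P : EuclideanSpace ℝ (Fin n) → UnitAddTorus (DyadicIndex m) :=
    torusPoint fun M : DyadicIndex m => ν s M with hP
  have hPc : Continuous P := continuous_torusPoint _
  have hspec : ∀ N : DyadicIndex m,
      ContDiff ℝ ∞ (fun x => (torusWeight q (P x) N : ℂ) * torusCoord (P x) N * φ x) ∧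
      Integrable (fun x => (torusWeight q (P x) N : ℂ) * torusCoord (P x) N * φ x) ∧
      tsupport (𝓕 (fun x => (torusWeight q (P x) N : ℂ) * torusCoord (P x) N * φ x)) ⊆
        Metric.closedBall (ν s N) (q.natDegree * ∑ M ∈ Finset.range N, ‖ν s M‖ + 1) := fun N => by
    have h := mul_trigPoly_spec hφs hφi hφsupp (ν s N)
      (torusWeight_torusPoint_mem_trigPoly q (ν s) N.2.2)
    have e : (fun x => (torusWeight q (P x) N : ℂ) * torusCoord (P x) N * φ x) = fun x =>
        planeWave (ν s N) x * (torusWeight q (P x) N : ℂ) * φ x := by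
      ext x
      rw [hP, torusCoord_torusPoint (ν s) x N.2, mul_comm (torusWeight _ _ _ : ℂ)]
    rw [e]
    exact h
  refine ⟨fun N x => (torusWeight q (P x) N : ℂ) * torusCoord (P x) N * φ x, fun N => ?_,
    fun N => ?_, fun p hp1 hp2 => ?_, ?_⟩
  · exact ⟨(hspec N).1, (hspec N).2.1, HasCompactSupport.of_support_subset_isCompact
      (isCompact_closedBall _ _) ((subset_tsupport _).trans (hspec N).2.2)⟩
  · refine (hspec N).2.2.trans ((Metric.closedBall_subset_closedBall ?_).trans
      ((hν s N).2.trans_eq ?_))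
    · have hσ : 0 ≤ ∑ M ∈ Finset.range N, ‖ν s M‖ := Finset.sum_nonneg fun _ _ => norm_nonneg _
      have h1 : (1 : ℝ) ≤ s := by exact_mod_cast (le_max_left _ _).trans hs3
      have h2 : (q.natDegree : ℝ) ≤ s := by exact_mod_cast (le_max_right _ _).trans hs3
      nlinarith [mul_le_mul_of_nonneg_right h2 hσ]
    · simp only [hYdef]
      rw [dif_pos N.2]
  · have e : (fun x => ∑ N : DyadicIndex m,
        (torusWeight q (P x) N : ℂ) * torusCoord (P x) N * φ x) = fun x => F (P x) * φ x := by
      ext x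
      rw [← Finset.sum_mul, hF]
      simp only [sum_Ico_eq_sum_dyadicIndex]
    rw [e]
    have hFPc : Continuous fun x => F (P x) := hFc.comp hPc
    have hFi : Integrable fun x => ‖F (P x)‖ ^ (2 * p₀) * ‖φ x‖ := by
      obtain ⟨C, hC⟩ := isCompact_univ.exists_bound_of_continuousOn
        (f := fun θ => ‖F θ‖ ^ (2 * p₀)) (by fun_prop)
      exact hφi.norm.bdd_mul (by fun_prop)
        (Filter.Eventually.of_forall fun x => hC (P x) (Set.mem_univ _))
    refine (eLpNorm_mul_le_of_integral_le hφc.measurable hFPc.measurable hφi hφ1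
      (A := A + 1) (by linarith) (by linarith) (B := (A * K + 1) * m ^ p₀) (by positivity)
      hFi hs1.le hp1 (by push_cast; exact hp2)).trans_eq ?_
    have hpow : ((m : ℝ) ^ p₀) ^ (1 / ((2 * p₀ : ℕ) : ℝ)) = √m := by
      rw [Real.sqrt_eq_rpow, ← Real.rpow_natCast, ← Real.rpow_mul hm0.le]
      congr 1
      have : (p₀ : ℝ) ≠ 0 := by positivity
      push_cast
      field_simp
    rw [Real.mul_rpow (by positivity) (by positivity), hpow, mul_assoc]
  · set S : Set (EuclideanSpace ℝ (Fin n)) := Q ∩ {x | m / 16 < torusMax q (P x)} with hS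
    have hSm : MeasurableSet S :=
      hQm.inter (isOpen_lt continuous_const (hMc.comp hPc)).measurableSet
    have hSfin : volume S ≠ ⊤ :=
      ((measure_mono Set.inter_subset_left).trans_lt hQfin.lt_top).ne
    -- The cutoff is at most `1` and vanishes where `torusMax q (P x) ≤ m / 16`, so its integral
    -- over `Q` bounds the volume of `S` from below.
    have hle : ∫ x, max 0 (min 1 (16 / m * torusMax q (P x) - 1)) *
        Q.indicator (1 : EuclideanSpace ℝ (Fin n) → ℝ) x ≤ volume.real S := by
      rw [← integral_indicator_one hSm]
      refine integral_mono_of_nonneg (Filter.Eventually.of_forall fun x => ?_)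
        ((integrable_indicator_iff hSm).2 (integrableOn_const hSfin))
        (Filter.Eventually.of_forall fun x => ?_)
      · exact mul_nonneg (le_max_left _ _) (Set.indicator_nonneg (fun _ _ => zero_le_one) x)
      · dsimp only
        by_cases hxQ : x ∈ Q
        · rw [Set.indicator_of_mem hxQ, Pi.one_apply, mul_one]
          by_cases hxM : m / 16 < torusMax q (P x)
          · rw [Set.indicator_of_mem (show x ∈ S from ⟨hxQ, hxM⟩)]
            exact max_le zero_le_one (min_le_left _ _)
          · rw [Set.indicator_of_notMem (show x ∉ S from fun h => hxM h.2)]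
            have : 16 / m * torusMax q (P x) ≤ 16 / m * (m / 16) := by
              gcongr
              exact not_lt.1 hxM
            have e : 16 / (m : ℝ) * (m / 16) = 1 := by field_simp
            exact max_le le_rfl ((min_le_right _ _).trans (by linarith))
        · rw [Set.indicator_of_notMem hxQ, mul_zero]
          exact Set.indicator_nonneg (fun _ _ => zero_le_one) x
    have hlt : ENNReal.ofReal (volume.real Q / 16) < volume S :=
      (ENNReal.ofReal_lt_iff_lt_toReal (by positivity) hSfin).2 (hs2.trans_le hle)
    refine hlt.trans_le (measure_mono fun x hx => ⟨hx.1.1, ?_⟩)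
    have hsum : ∀ l : DyadicIndex m, ‖∑ N ∈ Finset.univ.filter (fun N => N ≤ l),
        (torusWeight q (P x) (dyadicPerm m N) : ℂ) * torusCoord (P x) (dyadicPerm m N) * φ x‖ =
        ‖φ x‖ * ‖∑ N ∈ Finset.univ.filter (fun N => N ≤ l),
        (torusWeight q (P x) (dyadicPerm m N) : ℂ) * torusCoord (P x) (dyadicPerm m N)‖ :=
      fun l => by rw [← Finset.sum_mul, norm_mul, mul_comm]
    simp only [hsum]
    rw [← Real.mul_iSup_of_nonneg (norm_nonneg _)]
    change 1 / 32 * m ≤ ‖φ x‖ * torusMax q (P x)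
    have h1 : 1 / 2 < ‖φ x‖ := hx.1.2
    have h2 : m / 16 < torusMax q (P x) := hx.2
    calc (1 / 32 * m : ℝ) = 1 / 2 * (m / 16) := by ring
      _ ≤ _ := by gcongr
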